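/- **Setting.** Let $N\ge 2$, let $\Omega\subset\mathbb R^N$ be bounded and open, $0<T<\infty$, $\Omega_T=\Omega\times(0,T)$, and $\alpha,\beta>0$. Let $A:\Omega\times[0,T]\times\mathbb R^N\to\mathbb R^N$ and $B:\Omega\times[0,T]\times\mathbb R\to\mathbb R^N$ be Carathéodory on $\Omega_T$ (measurable in $(x,t)$, continuous in the last variable for a.e. $(x,t)$), and let $b,g:\Omega\times[0,T]\to\mathbb R$ be measurable on $\Omega_T$ with $g\in L^2(\Omega_T)$. Assume that for a.e. $(x,t)\in\Omega_T$ and all $\eta,\eta^*\in\mathbb R^N$, $z,z^*\in\mathbb R$, $$|A(x,t,\eta)|\le\beta|\eta|+g(x,t),\qquad \langle A(x,t,\eta)-A(x,t,\eta^*),\eta-\eta^*\rangle\ge\alpha|\eta-\eta^*|^2,$$ $$|B(x,t,z)-B(x,t,z^*)|\le b(x,t)|z-z^*|,\qquad B(x,t,0)=0.$$ Assume $b\in L^\infty(0,T;L^{N,\infty}(\Omega))$, where $\|\varphi\|_{L^{N,\infty}(\Omega)}=\sup_{m>0}m\,|\{x\in\Omega:|\varphi(x)|>m\}|^{1/N}$.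 Let $T_Ms=\max\{-M,\min\{s,M\}\}$, $\theta_M=T_M(b)/b$ (where $b=0$ its value is irrelevant, since $B=0$ there), and $S_{N,2}=\omega_N^{-1/N}\frac{2}{N-2}$, with $\omega_N$ the volume of the unit ball of $\mathbb R^N$; for $N=2$, $S_{2,2}=\infty$ and $\alpha/(2S_{2,2})=0$. Let $M>0$ be a truncation level with $$\operatorname*{ess\,sup}_{t\in(0,T)}\|b(\cdot,t)-T_M(b(\cdot,t))\|_{L^{N,\infty}(\Omega)}\le\frac{\alpha}{2S_{N,2}}.$$ Call $t\in[0,T]$ *admissible* if the hypotheses hold at time $t$, that is: $A(\cdot,t,\cdot)$ and $B(\cdot,t,\cdot)$ are Carathéodory on $\Omega$, $b(\cdot,t)$ is measurable, $g(\cdot,t)\in L^2(\Omega)$, the four structure conditions above hold at $(x,t)$ for a.e. $x\in\Omega$, $b(\cdot,t)\in L^{N,\infty}(\Omega)$, and $\|b(\cdot,t)-T_M(b(\cdot,t))\|_{L^{N,\infty}(\Omega)}\le\alpha/(2S_{N,2})$. **Claim.** Almost every $t\in(0,T)$ is admissible. For every admissible $t\in[0,T]$ and every $u\in W_0^{1,2}(\Omega)$,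 the field $A(\cdot,t,\nabla u)+(1-\theta_M(\cdot,t))B(\cdot,t,u)$ belongs to $L^2(\Omega;\mathbb R^N)$, so that $$\tilde A_M(t)u=-\operatorname{div}\big[A(x,t,\nabla u)+(1-\theta_M(x,t))B(x,t,u)\big],\qquad \langle\tilde A_M(t)u,v\rangle=\int_\Omega\big[A(x,t,\nabla u)+(1-\theta_M)B(x,t,u)\big]\cdot\nabla v\,dx,$$ defines an operator $\tilde A_M(t):W_0^{1,2}(\Omega)\to W^{-1,2}(\Omega)$. This operator is $m$-accretive in $L^2(\Omega)$, uniformly in $t$, in the following sense, where its graph in $L^2(\Omega)$ is $\{(u,y):u\in W_0^{1,2}(\Omega),\ y\in L^2(\Omega),\ \tilde A_M(t)u=y\}$: 1. (i) For all $u,v\in W_0^{1,2}(\Omega)$, $$\langle\tilde A_M(t)u-\tilde A_M(t)v,u-v\rangle_{W^{-1,2},W_0^{1,2}}\ge\frac{\alpha}{2}\|\nabla(u-v)\|_{L^2(\Omega)}^2 ;$$ in particular the graph of $\tilde A_M(t)$ in $L^2(\Omega)$ is accretive. 2. (ii) For every $\lambda>0$, $R(I+\lambda\tilde A_M(t))=L^2(\Omega)$: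 for each $f\in L^2(\Omega)$ there is $(u,y)$ in this graph with $u+\lambda y=f$. 3. (iii) For every $\lambda>0$, the resolvent $J_\lambda=(I+\lambda\tilde A_M(t))^{-1}$ is a single-valued map defined on all of $L^2(\Omega)$, and $\|J_\lambda f-J_\lambda f'\|_{L^2(\Omega)}\le\|f-f'\|_{L^2(\Omega)}$ for all $f,f'\in L^2(\Omega)$. -/

import Mathlib

open MeasureTheory Set
open scoped ENNReal ContDiff InnerProductSpace

noncomputable section

/-- The Euclidean space `ℝ^N`. -/
abbrev Eucl (N : ℕ) : Type := EuclideanSpace ℝ (Fin N)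

/-- `L²(Ω)`. -/
abbrev L2 {N : ℕ} (Ω : Set (Eucl N)) : Type := Lp ℝ 2 (volume.restrict Ω)

/-- `L²(Ω; ℝ^N)`. -/
abbrev L2Vec {N : ℕ} (Ω : Set (Eucl N)) : Type := Lp (Eucl N) 2 (volume.restrict Ω)

/-! ### The Sobolev space `W_0^{1,2}(Ω)` and its dual -/

/-- `φ ∈ C_c^∞(Ω)`. -/
structure IsTestFunction {N : ℕ} (Ω : Set (Eucl N)) (φ : Eucl N → ℝ) : Prop where
  smooth : ContDiff ℝ ∞ φ
  compact : HasCompactSupport φ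
  support : tsupport φ ⊆ Ω

/-- All pairs `(φ, ∇φ)` with `φ ∈ C_c^∞(Ω)`, in `L²(Ω) × L²(Ω; ℝ^N)`; the product carries the
Hilbert norm `(‖u‖² + ‖G‖²)^{1/2}`, so that the norm of `(φ, ∇φ)` is the `W^{1,2}` norm of `φ`. -/
def testPairs {N : ℕ} (Ω : Set (Eucl N)) : Submodule ℝ (WithLp 2 (L2 Ω × L2Vec Ω)) where
  carrier := {w | ∃ φ : Eucl N → ℝ, IsTestFunction Ω φ ∧
    w.fst =ᵐ[volume.restrict Ω] φ ∧ w.snd =ᵐ[volume.restrict Ω] gradient φ}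
  zero_mem' := by
    refine ⟨fun _ => 0, ⟨contDiff_const, HasCompactSupport.zero, ?_⟩, ?_, ?_⟩
    · simp [tsupport]
    · exact Lp.coeFn_zero _ _ _
    · filter_upwards [Lp.coeFn_zero (Eucl N) 2 (volume.restrict Ω)] with x hx
      have : gradient (fun _ : Eucl N => (0 : ℝ)) x = 0 := by simp [gradient]
      rw [this]
      exact hx
  add_mem' := by
    rintro v w ⟨φ, hφ, hv, hv'⟩ ⟨ψ, hψ, hw, hw'⟩
    refine ⟨φ + ψ, ⟨hφ.smooth.add hψ.smooth, hφ.compact.add hψ.compact, ?_⟩, ?_, ?_⟩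
    · exact (tsupport_add φ ψ).trans (union_subset hφ.support hψ.support)
    · filter_upwards [Lp.coeFn_add v.fst w.fst, hv, hw] with x h h1 h2
      change (v.fst + w.fst : L2 Ω) x = _
      rw [h, Pi.add_apply, Pi.add_apply, h1, h2]
    · filter_upwards [Lp.coeFn_add v.snd w.snd, hv', hw'] with x h h1 h2
      change (v.snd + w.snd : L2Vec Ω) x = _
      have hd := hφ.smooth.differentiable (by simp) x
      have hd' := hψ.smooth.differentiable (by simp) x
      rw [h, Pi.add_apply, h1, h2]
      simp only [gradient]
      rw [fderiv_add hd hd', map_add]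
  smul_mem' := by
    rintro c w ⟨φ, hφ, hw, hw'⟩
    refine ⟨c • φ, ⟨hφ.smooth.const_smul c, hφ.compact.smul_left, ?_⟩, ?_, ?_⟩
    · exact (closure_mono (Function.support_const_smul_subset c φ)).trans hφ.support
    · filter_upwards [Lp.coeFn_smul c w.fst, hw] with x h h1
      change (c • w.fst : L2 Ω) x = _
      rw [h, Pi.smul_apply, Pi.smul_apply, h1]
    · filter_upwards [Lp.coeFn_smul c w.snd, hw'] with x h h1
      change (c • w.snd : L2Vec Ω) x = _
      have hd := hφ.smooth.differentiable (by simp) x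
      rw [h, Pi.smul_apply, h1]
      simp only [gradient]
      rw [fderiv_const_smul hd, map_smul]

/-- `W_0^{1,2}(Ω)`: the closure of `C_c^∞(Ω)` in the `W^{1,2}` norm. An element is stored as the
pair `(u, ∇u)`; the second entry is the weak gradient of the first (`W012.integral_by_parts`). -/
def W012 {N : ℕ} (Ω : Set (Eucl N)) : Submodule ℝ (WithLp 2 (L2 Ω × L2Vec Ω)) :=
  (testPairs Ω).topologicalClosure

/-- The inclusion `W_0^{1,2}(Ω) → L²(Ω)`. -/
def W012.toL2 {N : ℕ} (Ω : Set (Eucl N)) : W012 Ω →L[ℝ] L2 Ω :=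
  (WithLp.fstL 2 ℝ (L2 Ω) (L2Vec Ω)).comp (W012 Ω).subtypeL

/-- The weak gradient `∇ : W_0^{1,2}(Ω) → L²(Ω; ℝ^N)`. -/
def W012.grad {N : ℕ} (Ω : Set (Eucl N)) : W012 Ω →L[ℝ] L2Vec Ω :=
  (WithLp.sndL 2 ℝ (L2 Ω) (L2Vec Ω)).comp (W012 Ω).subtypeL

/-- The second entry of an element of `W_0^{1,2}(Ω)` is the weak gradient of the first. -/
theorem W012.integral_by_parts {N : ℕ} {Ω : Set (Eucl N)} (u : W012 Ω)
    {φ : Eucl N → ℝ} (hφ : IsTestFunction Ω φ) (e : Eucl N) :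
    ∫ x in Ω, W012.toL2 Ω u x * fderiv ℝ φ x e =
      -∫ x in Ω, ⟪W012.grad Ω u x, e⟫_ℝ * φ x := by
  have hc : Continuous (fun x => fderiv ℝ φ x e) :=
    (hφ.smooth.continuous_fderiv (by simp)).clm_apply continuous_const
  have hP : MemLp (fun x => fderiv ℝ φ x e) 2 (volume.restrict Ω) :=
    (hc.memLp_of_hasCompactSupport (hφ.compact.fderiv_apply ℝ e)).restrict Ω
  have hQ : MemLp (fun x => φ x • e) 2 (volume.restrict Ω) :=
    ((hφ.smooth.continuous.smul continuous_const).memLp_of_hasCompactSupport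
      hφ.compact.smul_right).restrict Ω
  let L : WithLp 2 (L2 Ω × L2Vec Ω) →L[ℝ] ℝ :=
    (innerSL ℝ (hP.toLp _)).comp (WithLp.fstL 2 ℝ (L2 Ω) (L2Vec Ω)) +
      (innerSL ℝ (hQ.toLp _)).comp (WithLp.sndL 2 ℝ (L2 Ω) (L2Vec Ω))
  have hL : ∀ w, L w = (∫ x in Ω, w.fst x * fderiv ℝ φ x e) +
      ∫ x in Ω, ⟪w.snd x, e⟫_ℝ * φ x := by
    intro w
    change ⟪hP.toLp _, w.fst⟫_ℝ + ⟪hQ.toLp _, w.snd⟫_ℝ = _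
    rw [L2.inner_def, L2.inner_def]
    congr 1
    · refine integral_congr_ae ?_
      filter_upwards [hP.coeFn_toLp] with x hx
      rw [hx]
      simp
    · refine integral_congr_ae ?_
      filter_upwards [hQ.coeFn_toLp] with x hx
      rw [hx, real_inner_smul_left, real_inner_comm, mul_comm]
  have hle : W012 Ω ≤ LinearMap.ker L.toLinearMap := by
    refine Submodule.topologicalClosure_minimal _ ?_ L.isClosed_ker
    rintro w ⟨ψ, hψ, h1, h2⟩
    rw [LinearMap.mem_ker]
    change L w = 0
    have hd : Differentiable ℝ φ := hφ.smooth.differentiable (by simp)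
    have hd' : Differentiable ℝ ψ := hψ.smooth.differentiable (by simp)
    have hc' : Continuous (fun x => fderiv ℝ ψ x e) :=
      (hψ.smooth.continuous_fderiv (by simp)).clm_apply continuous_const
    have hz : ∀ x, x ∉ Ω → ψ x = 0 := fun x hx =>
      image_eq_zero_of_notMem_tsupport fun h => hx (hψ.support h)
    have hz' : ∀ x, x ∉ Ω → φ x = 0 := fun x hx =>
      image_eq_zero_of_notMem_tsupport fun h => hx (hφ.support h)
    have e1 : ∫ x in Ω, w.fst x * fderiv ℝ φ x e = ∫ x, ψ x * fderiv ℝ φ x e := by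
      rw [← setIntegral_eq_integral_of_forall_compl_eq_zero (s := Ω)
        (f := fun x => ψ x * fderiv ℝ φ x e) (fun x hx => by rw [hz x hx, zero_mul])]
      refine integral_congr_ae ?_
      filter_upwards [h1] with x hx
      rw [hx]
    have e2 : ∫ x in Ω, ⟪w.snd x, e⟫_ℝ * φ x = ∫ x, fderiv ℝ ψ x e * φ x := by
      rw [← setIntegral_eq_integral_of_forall_compl_eq_zero (s := Ω)
        (f := fun x => fderiv ℝ ψ x e * φ x) (fun x hx => by rw [hz' x hx, mul_zero])]
      refine integral_congr_ae ?_
      filter_upwards [h2] with x hx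
      rw [hx]
      simp [gradient]
    rw [hL, e1, e2, integral_mul_fderiv_eq_neg_fderiv_mul_of_integrable _ _ _
      (fun x _ => hd' x) (fun x _ => hd x),
      neg_add_cancel]
    · exact (hc'.mul hφ.smooth.continuous).integrable_of_hasCompactSupport
        hφ.compact.mul_left
    · exact (hψ.smooth.continuous.mul hc).integrable_of_hasCompactSupport
        hψ.compact.mul_right
    · exact (hψ.smooth.continuous.mul hφ.smooth.continuous).integrable_of_hasCompactSupport
        hψ.compact.mul_right
  have h0 : L u = 0 := hle u.2
  rw [hL] at h0
  exact eq_neg_of_add_eq_zero_left h0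

/-- `W^{-1,2}(Ω)`, the dual space of `W_0^{1,2}(Ω)`. -/
abbrev Wneg12 {N : ℕ} (Ω : Set (Eucl N)) : Type := StrongDual ℝ (W012 Ω)

/-- `L²(Ω) ⊂ W^{-1,2}(Ω)`: `⟨f, v⟩ = ∫_Ω f v dx`. -/
def L2.toWneg12 {N : ℕ} {Ω : Set (Eucl N)} (f : L2 Ω) : Wneg12 Ω :=
  (innerSL ℝ f).comp (W012.toL2 Ω)

/-- `-div F ∈ W^{-1,2}(Ω)` for `F ∈ L²(Ω; ℝ^N)`: `⟨-div F, v⟩ = ∫_Ω F · ∇v dx`. -/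
def negDiv {N : ℕ} {Ω : Set (Eucl N)} (F : L2Vec Ω) : Wneg12 Ω :=
  (innerSL ℝ F).comp (W012.grad Ω)

/-! ### Weak Lebesgue (Lorentz) quasi-norm, Sobolev constant, truncation -/

/-- `‖φ‖_{L^{p,∞}(Ω)} = sup_{m > 0} m |{x ∈ Ω : |φ(x)| > m}|^{1/p}`. -/
def weakLpNorm {N : ℕ} (Ω : Set (Eucl N)) (p : ℝ) (φ : Eucl N → ℝ) : ℝ≥0∞ :=
  ⨆ (m : ℝ) (_ : 0 < m),
    ENNReal.ofReal m * (volume.restrict Ω {x | m < |φ x|}) ^ (1 / p)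

/-- `S_{N,p} = ω_N^{-1/N} p / (N - p)` with `ω_N` the volume of the unit ball of `ℝ^N`. It is
finite for `p < N`, and `S_{N,N} = ∞`. -/
def sobolevConst (N : ℕ) (p : ℝ≥0∞) : ℝ≥0∞ :=
  (volume (Metric.ball (0 : Eucl N) 1)) ^ (-(1 / (N : ℝ))) * (p / ((N : ℝ≥0∞) - p))

/-- `T_M s = max {-M, min {s, M}}`. -/
def trunc (M s : ℝ) : ℝ := max (-M) (min s M)

/-! ### Structure conditions -/

/-- Carathéodory functions: measurable in the first variable, continuous in the second. -/
structure IsCaratheodory {X F G : Type*} [MeasurableSpace X] [TopologicalSpace F]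
    [TopologicalSpace G] (μ : Measure X) (f : X → F → G) : Prop where
  measurable : ∀ η, AEStronglyMeasurable (fun x => f x η) μ
  continuous : ∀ᵐ x ∂μ, Continuous (f x)

/-- The hypotheses on `A`, `B`, `b`, `g` over a measure space `(X, μ)`. It is used for
`X = Ω_T = Ω × (0, T)` and, at a fixed time, for `X = Ω`. -/
structure StructureConditions {X : Type*} [MeasurableSpace X] (μ : Measure X) {N : ℕ} (α β : ℝ)
    (A : X → Eucl N → Eucl N) (B : X → ℝ → Eucl N) (b g : X → ℝ) : Prop where
  caratheodory_A : IsCaratheodory μ A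
  memLp_g : MemLp g 2 μ
  growth_A : ∀ᵐ x ∂μ, ∀ η, ‖A x η‖ ≤ β * ‖η‖ + g x
  monotone_A : ∀ᵐ x ∂μ, ∀ η η', α * ‖η - η'‖ ^ 2 ≤ ⟪A x η - A x η', η - η'⟫_ℝ
  caratheodory_B : IsCaratheodory μ B
  measurable_b : AEStronglyMeasurable b μ
  lipschitz_B : ∀ᵐ x ∂μ, ∀ z z', ‖B x z - B x z'‖ ≤ b x * |z - z'|
  zero_B : ∀ᵐ x ∂μ, B x 0 = 0

/-- The hypotheses at one time: the structure conditions on `Ω`, `b ∈ L^{N,∞}(Ω)`, and the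
choice of the truncation level `‖b - T_M b‖_{L^{N,∞}(Ω)} ≤ α / (2 S_{N,2})`. -/
structure ConditionsAtTime {N : ℕ} (Ω : Set (Eucl N)) (α β M : ℝ)
    (A : Eucl N → Eucl N → Eucl N) (B : Eucl N → ℝ → Eucl N) (b g : Eucl N → ℝ) : Prop where
  structural : StructureConditions (volume.restrict Ω) α β A B b g
  weakLp_b : weakLpNorm Ω N b < ⊤
  truncation : weakLpNorm Ω N (fun x => b x - trunc M (b x)) ≤
    ENNReal.ofReal α / (2 * sobolevConst N 2)

/-! ### The truncated operator at a fixed time -/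

/-- The vector field `A(x, ∇u) + (1 - θ_M(x)) B(x, u)`, where `θ_M = T_M b / b`. (Where `b = 0`
the value of `θ_M` plays no role, as `B` vanishes there.) -/
def truncatedFlux {N : ℕ} {Ω : Set (Eucl N)} (M : ℝ) (A : Eucl N → Eucl N → Eucl N)
    (B : Eucl N → ℝ → Eucl N) (b : Eucl N → ℝ) (u : W012 Ω) (x : Eucl N) : Eucl N :=
  A x (W012.grad Ω u x) + (1 - trunc M (b x) / b x) • B x (W012.toL2 Ω u x)

open Classical in
/-- `u ↦ -div [A(x, ∇u) + (1 - θ_M) B(x, u)]`, from `W_0^{1,2}(Ω)` to `W^{-1,2}(Ω)`. The value is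
meaningful when the vector field is in `L²(Ω; ℝ^N)`, and is set to `0` otherwise. -/
def truncatedOperator {N : ℕ} {Ω : Set (Eucl N)} (M : ℝ) (A : Eucl N → Eucl N → Eucl N)
    (B : Eucl N → ℝ → Eucl N) (b : Eucl N → ℝ) (u : W012 Ω) : Wneg12 Ω :=
  if h : MemLp (truncatedFlux M A B b u) 2 (volume.restrict Ω) then negDiv (h.toLp _) else 0

/-- `⟨Ã u, v⟩ = ∫_Ω [A(x, ∇u) + (1 - θ_M) B(x, u)] · ∇v dx`. -/
theorem truncatedOperator_apply {N : ℕ} {Ω : Set (Eucl N)} (M : ℝ)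
    (A : Eucl N → Eucl N → Eucl N) (B : Eucl N → ℝ → Eucl N) (b : Eucl N → ℝ) (u v : W012 Ω)
    (h : MemLp (truncatedFlux M A B b u) 2 (volume.restrict Ω)) :
    truncatedOperator M A B b u v =
      ∫ x in Ω, ⟪truncatedFlux M A B b u x, W012.grad Ω v x⟫_ℝ := by
  rw [truncatedOperator, dif_pos h]
  change ⟪h.toLp _, W012.grad Ω v⟫_ℝ = _
  rw [L2.inner_def]
  refine integral_congr_ae ?_
  filter_upwards [h.coeFn_toLp] with x hx
  rw [hx]

/-! ### Multivalued operators in a Hilbert space, given by their graphs -/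

/-- Accretivity in a real Hilbert space (whose normalized duality map is the identity). -/
def IsAccretive {H : Type*} [NormedAddCommGroup H] [InnerProductSpace ℝ H]
    (G : Set (H × H)) : Prop :=
  ∀ p ∈ G, ∀ q ∈ G, 0 ≤ ⟪p.2 - q.2, p.1 - q.1⟫_ℝ

/-- The range `R(I + κ G)`. -/
def rangeIdAdd {H : Type*} [NormedAddCommGroup H] [InnerProductSpace ℝ H]
    (κ : ℝ) (G : Set (H × H)) : Set H :=
  {f | ∃ p ∈ G, p.1 + κ • p.2 = f}

/-- `J = (I + κ G)⁻¹` as an everywhere defined, single-valued map. -/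
def IsResolvent {H : Type*} [NormedAddCommGroup H] [InnerProductSpace ℝ H]
    (κ : ℝ) (G : Set (H × H)) (J : H → H) : Prop :=
  ∀ f u, J f = u ↔ ∃ y, (u, y) ∈ G ∧ u + κ • y = f

/-- The graph in `L²(Ω) × L²(Ω)` of an operator `W_0^{1,2}(Ω) → W^{-1,2}(Ω)`: all `(u, y)` with
`u ∈ W_0^{1,2}(Ω)` and `𝒜 u = y ∈ L²(Ω)`. -/
def graphL2 {N : ℕ} {Ω : Set (Eucl N)} (𝒜 : W012 Ω → Wneg12 Ω) : Set (L2 Ω × L2 Ω) :=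
  {p | ∃ u : W012 Ω, W012.toL2 Ω u = p.1 ∧ 𝒜 u = L2.toWneg12 p.2}

end

/-! The principal part `A` is strongly monotone with constant `α`. Since `(1 - θ_M) b = b - T_M b`,
the lower order part is Lipschitz in `u` with pointwise constant `|b - T_M b|`, whose weak `L^N`
norm is at most `α / (2 S_{N,2})`. Alvino's inequality `‖ψ u‖₂ ≤ S_{N,2} ‖ψ‖_{N,∞} ‖∇u‖₂` makes this
part Lipschitz from the gradient norm to `L²` with constant `α / 2`
(`ConditionsAtTime.eLpNorm_lowerFlux_sub_le`), so half of the monotonicity survives. This is (i).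
For `N = 2` the excess `b - T_M b` vanishes almost everywhere.

The sharp constant is what the argument needs, and it comes from the isoperimetric inequality.
Prékopa–Leindler gives Brunn–Minkowski, which bounds the volume of a thickened set from below
(`volume_add_le_volume_thickening`). Thickening the superlevel sets of `φ` and integrating over
levels bounds `∫ f(|φ|) |∇φ|` from below for monotone `f` (`lintegral_mul_rpow_le`), with no coarea
formula. A suitable `f` and Cauchy–Schwarz give the Lorentz–Sobolev inequality `lorentzIntegral_le`,
and a layer-cake estimate for weights in weak `L^N` turns it into Alvino's inequality
(`setLIntegral_sq_mul_sq_le`). Density carries it to `W_0^{1,2}(Ω)`.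

For (ii), `u ↦ u + κ 𝒜 u` is strongly monotone and hemicontinuous from `W_0^{1,2}(Ω)` to its dual,
hence onto by Minty's theorem, proved here through the Fitzpatrick function. Then (iii) is the usual
Hilbert space consequence of accretivity and the range condition. That almost every time is
admissible is Fubini, with separability handling the continuous variable of Carathéodory functions.
-/

noncomputable section

/-! ### Prékopa–Leindler, Brunn–Minkowski and the isoperimetric inequality for sets -/

/-- The one-dimensional Brunn–Minkowski inequality for compact sets. -/
theorem volume_add_le_of_isCompact {K L C : Set ℝ} (hK : IsCompact K) (hL : IsCompact L)
    (hK0 : K.Nonempty) (hL0 : L.Nonempty) (h : ∀ x ∈ K, ∀ y ∈ L, x + y ∈ C) :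
    volume K + volume L ≤ volume C := by
  have hα := hK.sSup_mem hK0
  have hβ := hL.sInf_mem hL0
  set α := sSup K
  set β := sInf L
  -- Translating `K` by the least point of `L`, and `L` by the greatest point of `K`, gives two
  -- subsets of `C` that can meet only in `α + β`.
  have h1 : (fun x => x + β) '' K ∪ (fun y => α + y) '' L ⊆ C := by
    rintro _ (⟨x, hx, rfl⟩ | ⟨y, hy, rfl⟩)
    · exact h x hx β hβ
    · exact h α hα y hy
  refine le_trans ?_ (measure_mono h1)
  have hd : AEDisjoint volume ((fun x => x + β) '' K) ((fun y => α + y) '' L) := by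
    refine measure_mono_null (t := {α + β}) ?_ (by simp)
    rintro _ ⟨⟨x, hx, rfl⟩, ⟨y, hy, hxy⟩⟩
    have h2 : x ≤ α := le_csSup hK.bddAbove hx
    have h3 : β ≤ y := csInf_le hL.bddBelow hy
    simp only at hxy
    simp only [mem_singleton_iff]
    linarith
  have hm : NullMeasurableSet ((fun y => α + y) '' L) volume :=
    (hL.image (by fun_prop)).measurableSet.nullMeasurableSet
  rw [measure_union₀ hm hd]
  simp [measure_preimage_add_right]

/-- Inner regularity reduces this to compact sets. A point of `A` and a point of `B` are added to
the compact subsets so that these are never empty. -/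
theorem volume_smul_add_le {a b : ℝ} (ha : 0 < a) (hb : 0 < b) {A B C : Set ℝ}
    (hA : MeasurableSet A) (hB : MeasurableSet B) (hA0 : A.Nonempty) (hB0 : B.Nonempty)
    (h : ∀ x ∈ A, ∀ y ∈ B, a * x + b * y ∈ C) :
    ENNReal.ofReal a * volume A + ENNReal.ofReal b * volume B ≤ volume C := by
  have key : ∀ K ⊆ A, ∀ L ⊆ B, IsCompact K → IsCompact L →
      ENNReal.ofReal a * volume K + ENNReal.ofReal b * volume L ≤ volume C := by
    intro K hKA L hLB hK hL
    obtain ⟨x0, hx0⟩ := hA0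
    obtain ⟨y0, hy0⟩ := hB0
    have hK' : IsCompact ((fun x => a * x) '' (insert x0 K)) := (hK.insert x0).image (by fun_prop)
    have hL' : IsCompact ((fun x => b * x) '' (insert y0 L)) := (hL.insert y0).image (by fun_prop)
    have := volume_add_le_of_isCompact (C := C) hK' hL' ⟨_, mem_image_of_mem _ (mem_insert x0 K)⟩
      ⟨_, mem_image_of_mem _ (mem_insert y0 L)⟩ ?_
    · refine le_trans ?_ this
      have e : ∀ (c : ℝ) (S : Set ℝ), 0 < c → volume ((fun x => c * x) '' S) =
          ENNReal.ofReal c * volume S := by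
        intro c S hc
        have := Measure.addHaar_smul (volume : Measure ℝ) c S
        simp only [Module.finrank_self, pow_one, abs_of_pos hc] at this
        exact this
      rw [e a _ ha, e b _ hb]
      gcongr <;> exact subset_insert _ _
    · rintro _ ⟨x, hx, rfl⟩ _ ⟨y, hy, rfl⟩
      refine h x ?_ y ?_
      · rcases hx with rfl | hx
        exacts [hx0, hKA hx]
      · rcases hy with rfl | hy
        exacts [hy0, hLB hy]
  have e : ∀ {S : Set ℝ}, MeasurableSet S →
      volume S = ⨆ K : {K : Set ℝ // K ⊆ S ∧ IsCompact K}, volume K.1 := fun hS => by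
    rw [hS.measure_eq_iSup_isCompact, iSup_subtype]
    simp only [iSup_and]
  rw [e hA, e hB]
  simp only [ENNReal.mul_iSup]
  have : ∀ S : Set ℝ, Nonempty {K : Set ℝ // K ⊆ S ∧ IsCompact K} := fun S =>
    ⟨⟨∅, empty_subset _, isCompact_empty⟩⟩
  exact ENNReal.iSup_add_iSup_le fun K L => key K.1 K.2.1 L.1 L.2.1 K.2.2 L.2.2

/-- One-dimensional Prékopa–Leindler for functions with supremum `1`. -/
theorem lintegral_ge_of_sup_eq_one {a b : ℝ} (ha : 0 < a) (hb : 0 < b) (hab : a + b = 1)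
    {f g h : ℝ → ℝ} (hf : Measurable f) (hg : Measurable g) (hh : Measurable h)
    (hf0 : ∀ x, 0 ≤ f x) (hg0 : ∀ x, 0 ≤ g x) (hh0 : ∀ x, 0 ≤ h x)
    (hf1 : ∀ x, f x ≤ 1) (hg1 : ∀ x, g x ≤ 1) (hf2 : ∀ t < 1, ∃ x, t < f x)
    (hg2 : ∀ t < 1, ∃ x, t < g x)
    (H : ∀ x y, f x ^ a * g y ^ b ≤ h (a * x + b * y)) :
    ENNReal.ofReal a * (∫⁻ x, ENNReal.ofReal (f x)) +
      ENNReal.ofReal b * (∫⁻ x, ENNReal.ofReal (g x)) ≤ ∫⁻ x, ENNReal.ofReal (h x) := by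
  have lc : ∀ {f : ℝ → ℝ}, Measurable f → (∀ x, 0 ≤ f x) →
      ∫⁻ x, ENNReal.ofReal (f x) = ∫⁻ t in Ioi (0 : ℝ), volume {x | t < f x} := fun hf h0 =>
    lintegral_eq_lintegral_meas_lt _ (Filter.Eventually.of_forall h0) hf.aemeasurable
  have lc1 : ∀ {f : ℝ → ℝ}, Measurable f → (∀ x, 0 ≤ f x) → (∀ x, f x ≤ 1) →
      ∫⁻ x, ENNReal.ofReal (f x) = ∫⁻ t in Ioo (0 : ℝ) 1, volume {x | t < f x} := by
    intro f hf h0 h1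
    rw [lc hf h0, ← Ioo_union_Ici_eq_Ioi (zero_lt_one (α := ℝ)),
      lintegral_union measurableSet_Ici]
    · rw [setLIntegral_congr_fun (g := fun _ => 0) measurableSet_Ici]
      · simp
      · intro t ht
        have : {x | t < f x} = ∅ := by
          ext x
          simpa using (h1 x).trans ht
        simp [this]
    · rw [Set.disjoint_left]
      intro x hx hx'
      exact absurd hx.2 (not_lt.2 hx')
  have anti : ∀ f : ℝ → ℝ, Measurable fun t : ℝ => volume {x | t < f x} := fun f =>
    Antitone.measurable fun s t hst => measure_mono fun x hx => lt_of_le_of_lt hst hx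
  rw [lc1 hf hf0 hf1, lc1 hg hg0 hg1, lc hh hh0, ← lintegral_const_mul _ (anti f),
    ← lintegral_const_mul _ (anti g), ← lintegral_add_left ((anti f).const_mul _)]
  -- For levels in `(0, 1)` the superlevel sets of `f` and `g` are nonempty, so the one-dimensional
  -- set inequality applies level by level. The levels of `h` beyond `1` are discarded.
  refine le_trans ?_ (lintegral_mono_set (Ioo_subset_Ioi_self : Ioo (0 : ℝ) 1 ⊆ _))
  refine setLIntegral_mono (anti h) fun t ht => ?_
  refine volume_smul_add_le ha hb (measurableSet_lt measurable_const hf)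
    (measurableSet_lt measurable_const hg) (hf2 t ht.2) (hg2 t ht.2) fun x hx y hy => ?_
  refine lt_of_lt_of_le ?_ (H x y)
  have h1 : t = t ^ a * t ^ b := by
    rw [← Real.rpow_add ht.1, hab, Real.rpow_one]
  rw [h1]
  have h2 := Real.rpow_lt_rpow ht.1.le hx ha
  have h3 := Real.rpow_lt_rpow ht.1.le hy hb
  exact mul_lt_mul'' h2 h3 (Real.rpow_nonneg ht.1.le _) (Real.rpow_nonneg ht.1.le _)

theorem ENNReal.rpow_mul_rpow_le_add {a b : ℝ} (ha : 0 < a) (hb : 0 < b) (hab : a + b = 1)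
    {F G : ℝ≥0∞} (hF : F ≠ ⊤) (hG : G ≠ ⊤) :
    F ^ a * G ^ b ≤ ENNReal.ofReal a * F + ENNReal.ofReal b * G := by
  lift F to NNReal using hF
  lift G to NNReal using hG
  rw [← ENNReal.ofReal_coe_nnreal, ← ENNReal.ofReal_coe_nnreal,
    ENNReal.ofReal_rpow_of_nonneg F.coe_nonneg ha.le, ENNReal.ofReal_rpow_of_nonneg G.coe_nonneg hb.le,
    ← ENNReal.ofReal_mul (by positivity), ← ENNReal.ofReal_mul ha.le, ← ENNReal.ofReal_mul hb.le,
    ← ENNReal.ofReal_add (by positivity) (by positivity)]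
  exact ENNReal.ofReal_le_ofReal
    (Real.geom_mean_le_arith_mean2_weighted ha.le hb.le F.coe_nonneg G.coe_nonneg hab)

/-- The one-dimensional Prékopa–Leindler inequality for bounded functions. -/
theorem prekopa_leindler_real {a b : ℝ} (ha : 0 < a) (hb : 0 < b) (hab : a + b = 1)
    {f g h : ℝ → ℝ} (hf : Measurable f) (hg : Measurable g) (hh : Measurable h)
    (hf0 : ∀ x, 0 ≤ f x) (hg0 : ∀ x, 0 ≤ g x) (hh0 : ∀ x, 0 ≤ h x)
    (hf1 : BddAbove (range f)) (hg1 : BddAbove (range g))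
    (hfi : ∫⁻ x, ENNReal.ofReal (f x) ≠ ⊤) (hgi : ∫⁻ x, ENNReal.ofReal (g x) ≠ ⊤)
    (H : ∀ x y, f x ^ a * g y ^ b ≤ h (a * x + b * y)) :
    (∫⁻ x, ENNReal.ofReal (f x)) ^ a * (∫⁻ x, ENNReal.ofReal (g x)) ^ b ≤
      ∫⁻ x, ENNReal.ofReal (h x) := by
  have pos_or : ∀ {f : ℝ → ℝ}, (∀ x, 0 ≤ f x) → BddAbove (range f) →
      (∫⁻ x, ENNReal.ofReal (f x) = 0) ∨ 0 < ⨆ x, f x := by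
    intro f h0 hb
    by_cases hx : ∃ x, 0 < f x
    · obtain ⟨x, hx⟩ := hx
      exact Or.inr (hx.trans_le (le_ciSup hb x))
    · left
      push Not at hx
      simp [ENNReal.ofReal_eq_zero.2 (hx _)]
  rcases pos_or hf0 hf1 with hF | hF
  · simp [hF, ha]
  rcases pos_or hg0 hg1 with hG | hG
  · simp [hG, hb]
  set p := ⨆ x, f x
  set q := ⨆ x, g x
  have hm : 0 < p ^ a * q ^ b := by positivity
  -- Normalizing `f` and `g` by their suprema and `h` by `p ^ a * q ^ b` preserves the hypothesis.
  -- The additive bound then implies the multiplicative one by the arithmetic–geometric mean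
  -- inequality.
  have key := lintegral_ge_of_sup_eq_one ha hb hab (hf.div_const p) (hg.div_const q)
    (hh.div_const (p ^ a * q ^ b)) (fun x => div_nonneg (hf0 x) hF.le)
    (fun x => div_nonneg (hg0 x) hG.le) (fun x => div_nonneg (hh0 x) hm.le)
    (fun x => div_le_one_of_le₀ (le_ciSup hf1 x) hF.le)
    (fun x => div_le_one_of_le₀ (le_ciSup hg1 x) hG.le)
    (fun t ht => by
      obtain ⟨x, hx⟩ := exists_lt_of_lt_ciSup (f := f) (show t * p < p by nlinarith)
      exact ⟨x, (lt_div_iff₀ hF).2 hx⟩)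
    (fun t ht => by
      obtain ⟨x, hx⟩ := exists_lt_of_lt_ciSup (f := g) (show t * q < q by nlinarith)
      exact ⟨x, (lt_div_iff₀ hG).2 hx⟩)
    (fun x y => by
      rw [Real.div_rpow (hf0 x) hF.le, Real.div_rpow (hg0 y) hG.le, div_mul_div_comm]
      exact div_le_div_of_nonneg_right (H x y) hm.le)
  have hdiv : ∀ {f : ℝ → ℝ} {c : ℝ}, Measurable f → 0 < c →
      ∫⁻ x, ENNReal.ofReal (f x) = ENNReal.ofReal c * ∫⁻ x, ENNReal.ofReal (f x / c) := by
    intro f c hf hc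
    rw [← lintegral_const_mul _ (hf.div_const c).ennreal_ofReal]
    refine lintegral_congr fun x => ?_
    rw [← ENNReal.ofReal_mul hc.le, mul_div_cancel₀ _ hc.ne']
  rw [hdiv hf hF] at hfi
  rw [hdiv hg hG] at hgi
  rw [hdiv hf hF, hdiv hg hG, hdiv hh hm, ENNReal.mul_rpow_of_nonneg _ _ ha.le,
    ENNReal.mul_rpow_of_nonneg _ _ hb.le, mul_mul_mul_comm,
    ENNReal.ofReal_rpow_of_pos hF, ENNReal.ofReal_rpow_of_pos hG,
    ← ENNReal.ofReal_mul (by positivity)]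
  gcongr
  refine le_trans (ENNReal.rpow_mul_rpow_le_add ha hb hab ?_ ?_) key
  · exact fun h => hfi (by rw [h, ENNReal.mul_top (by simpa using hF)])
  · exact fun h => hgi (by rw [h, ENNReal.mul_top (by simpa using hG)])

/-- The multiplicative Brunn–Minkowski inequality. -/
theorem volume_rpow_mul_rpow_le {a b : ℝ} (ha : 0 < a) (hb : 0 < b) (hab : a + b = 1) (n : ℕ) :
    ∀ {A B C : Set (Fin n → ℝ)}, MeasurableSet A → MeasurableSet B → MeasurableSet C →
      Bornology.IsBounded A → Bornology.IsBounded B → Bornology.IsBounded C →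
      (∀ x ∈ A, ∀ y ∈ B, a • x + b • y ∈ C) → volume A ^ a * volume B ^ b ≤ volume C := by
  induction n with
  | zero =>
    intro A B C _ _ _ _ _ _ H
    rcases A.eq_empty_or_nonempty with rfl | ⟨x, hx⟩
    · simp [ha]
    rcases B.eq_empty_or_nonempty with rfl | ⟨y, hy⟩
    · simp [hb]
    have hz := H x hx y hy
    have e : ∀ {S : Set (Fin 0 → ℝ)} {x}, x ∈ S → volume S = 1 := by
      intro S x hx
      have : S = univ := by
        ext z
        simpa [Subsingleton.elim z x] using hx
      rw [this, volume_pi, Measure.pi_of_empty]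
      simp
    simp [e hx, e hy, e hz]
  | succ n ih =>
    intro A B C hA hB hC hA' hB' hC' H
    -- Slice along the first coordinate. The induction hypothesis on slices says that the slice
    -- volumes satisfy the hypothesis of the one-dimensional Prékopa–Leindler inequality.
    -- Boundedness keeps these volumes finite and bounded.
    let e := MeasurableEquiv.piFinSuccAbove (fun _ : Fin (n + 1) => ℝ) 0
    have he : MeasurePreserving e.symm :=
      (volume_preserving_piFinSuccAbove (fun _ : Fin (n + 1) => ℝ) 0).symm
    let sec : Set (Fin (n + 1) → ℝ) → ℝ → Set (Fin n → ℝ) := fun S s => {y | e.symm (s, y) ∈ S}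
    have hes : ∀ s y, e.symm (s, y) = Fin.cons s y := fun s y => by
      simp [e, MeasurableEquiv.piFinSuccAbove, Fin.insertNthEquiv]
    have hsm : ∀ {S}, MeasurableSet S → ∀ s, MeasurableSet (sec S s) := fun hS s =>
      (e.symm.measurable.comp measurable_prodMk_left) hS
    have hsb : ∀ {S}, Bornology.IsBounded S → ∃ R, ∀ s, sec S s ⊆ Metric.closedBall 0 R := by
      intro S hS
      obtain ⟨R, hR⟩ := hS.subset_closedBall 0
      refine ⟨R, fun s y hy => ?_⟩
      have h1 := hR hy
      rw [mem_closedBall_zero_iff] at h1 ⊢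
      refine le_trans ?_ h1
      refine (pi_norm_le_iff_of_nonneg (norm_nonneg _)).2 fun i => ?_
      have := norm_le_pi_norm (e.symm (s, y)) i.succ
      rwa [hes, Fin.cons_succ, ← hes] at this
    have hvol : ∀ {S}, MeasurableSet S → Bornology.IsBounded S →
        volume S = ∫⁻ s, ENNReal.ofReal (volume (sec S s)).toReal := by
      intro S hS hb
      rw [← he.measure_preimage hS.nullMeasurableSet, Measure.volume_eq_prod,
        Measure.prod_apply (e.symm.measurable hS)]
      refine lintegral_congr fun s => ?_
      obtain ⟨R, hR⟩ := hsb hb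
      rw [ENNReal.ofReal_toReal]
      · rfl
      · exact ((measure_mono (hR s)).trans_lt measure_closedBall_lt_top).ne
    have hmeas : ∀ {S}, MeasurableSet S → Measurable fun s => (volume (sec S s)).toReal :=
      fun hS => (measurable_measure_prodMk_left (e.symm.measurable hS)).ennreal_toReal
    have hbdd : ∀ {S}, Bornology.IsBounded S →
        BddAbove (range fun s => (volume (sec S s)).toReal) := by
      intro S hS
      obtain ⟨R, hR⟩ := hsb hS
      refine ⟨(volume (Metric.closedBall (0 : Fin n → ℝ) R)).toReal, ?_⟩
      rintro _ ⟨s, rfl⟩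
      exact ENNReal.toReal_mono measure_closedBall_lt_top.ne (measure_mono (hR s))
    have hsb' : ∀ {S}, Bornology.IsBounded S → ∀ s, Bornology.IsBounded (sec S s) := by
      intro S hS s
      obtain ⟨R, hR⟩ := hsb hS
      exact Metric.isBounded_closedBall.subset (hR s)
    rw [hvol hA hA', hvol hB hB', hvol hC hC']
    refine prekopa_leindler_real ha hb hab (hmeas hA) (hmeas hB) (hmeas hC)
      (fun _ => ENNReal.toReal_nonneg) (fun _ => ENNReal.toReal_nonneg)
      (fun _ => ENNReal.toReal_nonneg) (hbdd hA') (hbdd hB') ?_ ?_ fun s t => ?_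
    · rw [← hvol hA hA']
      exact hA'.measure_lt_top.ne
    · rw [← hvol hB hB']
      exact hB'.measure_lt_top.ne
    · rw [ENNReal.toReal_rpow, ENNReal.toReal_rpow, ← ENNReal.toReal_mul]
      refine ENNReal.toReal_mono (hsb' hC' _).measure_lt_top.ne
        (ih (hsm hA s) (hsm hB t) (hsm hC _) (hsb' hA' s) (hsb' hB' t) (hsb' hC' _) ?_)
      intro x hx y hy
      have := H _ hx _ hy
      change e.symm _ ∈ C
      convert this using 1
      rw [hes, hes, hes]
      ext i
      refine Fin.cases ?_ (fun j => ?_) i <;> simp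

open scoped Pointwise in
theorem EuclideanSpace.volume_rpow_mul_rpow_le {a b : ℝ} (ha : 0 < a) (hb : 0 < b)
    (hab : a + b = 1) {N : ℕ} {A B C : Set (Eucl N)} (hA : MeasurableSet A)
    (hB : MeasurableSet B) (hC : MeasurableSet C) (hA' : Bornology.IsBounded A)
    (hB' : Bornology.IsBounded B) (hC' : Bornology.IsBounded C)
    (H : ∀ x ∈ A, ∀ y ∈ B, a • x + b • y ∈ C) :
    volume A ^ a * volume B ^ b ≤ volume C := by
  have he : MeasurePreserving (WithLp.toLp 2 : (Fin N → ℝ) → Eucl N) :=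
    PiLp.volume_preserving_toLp (Fin N)
  have hb : ∀ {S : Set (Eucl N)}, Bornology.IsBounded S →
      Bornology.IsBounded ((WithLp.toLp 2 : (Fin N → ℝ) → Eucl N) ⁻¹' S) := by
    intro S hS
    have : (WithLp.toLp 2 : (Fin N → ℝ) → Eucl N) ⁻¹' S = WithLp.ofLp '' S := by
      ext x
      constructor
      · intro hx
        exact ⟨_, hx, rfl⟩
      · rintro ⟨y, hy, rfl⟩
        exact hy
    rw [this]
    exact (PiLp.lipschitzWith_ofLp 2 (fun _ : Fin N => ℝ)).isBounded_image hS
  rw [← he.measure_preimage hA.nullMeasurableSet, ← he.measure_preimage hB.nullMeasurableSet,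
    ← he.measure_preimage hC.nullMeasurableSet]
  exact _root_.volume_rpow_mul_rpow_le ha ‹_› hab N (he.measurable hA) (he.measurable hB)
    (he.measurable hC) (hb hA') (hb hB') (hb hC') fun x hx y hy => H _ hx _ hy

open scoped Pointwise in
/-- The Brunn–Minkowski inequality for the sum of an open set and a ball. -/
theorem add_pow_le_volume_thickening {N : ℕ} (hN : N ≠ 0) {A : Set (Eucl N)} (hA : IsOpen A)
    (hAb : Bornology.IsBounded A) (hA0 : A.Nonempty) {ε : ℝ} (hε : 0 < ε) :
    ((volume A).toReal ^ (1 / (N : ℝ)) +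
      ε * (volume (Metric.ball (0 : Eucl N) 1)).toReal ^ (1 / (N : ℝ))) ^ N ≤
      (volume (Metric.thickening ε A)).toReal := by
  have : Nonempty (Fin N) := ⟨⟨0, Nat.pos_of_ne_zero hN⟩⟩
  have hN' : (N : ℝ) ≠ 0 := by exact_mod_cast hN
  have hCb : Bornology.IsBounded (Metric.thickening ε A) := hAb.thickening
  have hVA : 0 < (volume A).toReal :=
    ENNReal.toReal_pos (hA.measure_pos _ hA0).ne' hAb.measure_lt_top.ne
  have hv : 0 < (volume (Metric.ball (0 : Eucl N) 1)).toReal :=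
    ENNReal.toReal_pos (Metric.measure_ball_pos _ _ one_pos).ne' measure_ball_lt_top.ne
  set V := (volume A).toReal
  set v := (volume (Metric.ball (0 : Eucl N) 1)).toReal
  set p := V ^ (1 / (N : ℝ))
  set q := ε * v ^ (1 / (N : ℝ))
  have hp : 0 < p := by positivity
  have hq : 0 < q := by positivity
  have hpN : p ^ N = V := by
    rw [← Real.rpow_natCast, ← Real.rpow_mul hVA.le, one_div_mul_cancel hN', Real.rpow_one]
  have hqN : q ^ N = ε ^ N * v := by
    rw [mul_pow, ← Real.rpow_natCast (v ^ _), ← Real.rpow_mul hv.le, one_div_mul_cancel hN',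
      Real.rpow_one]
  -- With these weights `a⁻¹ • A` and the ball of radius `b⁻¹ * ε` both have volume `(p + q) ^ N`,
  -- so their weighted geometric mean is also `(p + q) ^ N`.
  set a := p / (p + q)
  set b := q / (p + q)
  have ha : 0 < a := by positivity
  have hb : 0 < b := by positivity
  have hab : a + b = 1 := by
    rw [← add_div, div_self (by positivity)]
  have key := EuclideanSpace.volume_rpow_mul_rpow_le ha hb hab (A := a⁻¹ • A)
    (B := (b⁻¹ * ε) • Metric.ball (0 : Eucl N) 1) (C := Metric.thickening ε A)
    (hA.smul₀ (by positivity)).measurableSet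
    (Metric.isOpen_ball.smul₀ (by positivity)).measurableSet
    Metric.isOpen_thickening.measurableSet (hAb.smul₀ _) (Metric.isBounded_ball.smul₀ _) hCb ?_
  · have e : ∀ {c : ℝ} (S : Set (Eucl N)), 0 < c →
        volume (c • S) = ENNReal.ofReal (c ^ N) * volume S := by
      intro c S hc
      rw [Measure.addHaar_smul, finrank_euclideanSpace_fin, abs_of_pos (by positivity)]
    rw [e _ (by positivity), e _ (by positivity)] at key
    have h1 : (ENNReal.ofReal (a⁻¹ ^ N) * volume A).toReal = (p + q) ^ N := by
      rw [ENNReal.toReal_mul, ENNReal.toReal_ofReal (by positivity)]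
      change a⁻¹ ^ N * V = _
      rw [← hpN, ← mul_pow]
      congr 1
      simp only [a]
      field_simp
    have h2 : (ENNReal.ofReal ((b⁻¹ * ε) ^ N) * volume (Metric.ball (0 : Eucl N) 1)).toReal =
        (p + q) ^ N := by
      rw [ENNReal.toReal_mul, ENNReal.toReal_ofReal (by positivity)]
      change (b⁻¹ * ε) ^ N * v = _
      rw [mul_pow, mul_assoc, ← hqN, ← mul_pow]
      congr 1
      simp only [b]
      field_simp
    have := ENNReal.toReal_mono hCb.measure_lt_top.ne key
    rw [ENNReal.toReal_mul, ← ENNReal.toReal_rpow, ← ENNReal.toReal_rpow, h1, h2,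
      ← Real.rpow_add (by positivity), hab, Real.rpow_one] at this
    exact this
  · rintro _ ⟨x, hx, rfl⟩ _ ⟨y, hy, rfl⟩
    rw [Metric.mem_thickening_iff]
    refine ⟨x, hx, ?_⟩
    simp only [smul_smul]
    rw [mul_inv_cancel₀ ha.ne', mul_inv_cancel_left₀ hb.ne', one_smul, dist_eq_norm,
      add_sub_cancel_left, norm_smul, Real.norm_of_nonneg hε.le]
    rw [mem_ball_zero_iff] at hy
    nlinarith [norm_nonneg y]

/-- The isoperimetric inequality, in the form of a lower bound for the volume of a thickening. -/
theorem volume_add_le_volume_thickening {N : ℕ} (hN : 2 ≤ N) {A : Set (Eucl N)} (hA : IsOpen A)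
    (hAb : Bornology.IsBounded A) {ε : ℝ} (hε : 0 < ε) :
    volume A + ENNReal.ofReal ε * (N * volume (Metric.ball (0 : Eucl N) 1) ^ (1 / (N : ℝ)) *
      volume A ^ (1 - 1 / (N : ℝ))) ≤ volume (Metric.thickening ε A) := by
  have hN2 : (2 : ℝ) ≤ N := by exact_mod_cast hN
  have hs : 0 < 1 - 1 / (N : ℝ) := by
    rw [sub_pos, div_lt_one] <;> linarith
  rcases A.eq_empty_or_nonempty with rfl | hA0
  · rw [measure_empty, ENNReal.zero_rpow_of_pos hs]
    simp
  have hCb : Bornology.IsBounded (Metric.thickening ε A) := hAb.thickening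
  have key := add_pow_le_volume_thickening (by lia) hA hAb hA0 hε
  have hVt := hAb.measure_lt_top (μ := volume).ne
  have hvt : volume (Metric.ball (0 : Eucl N) 1) ≠ ⊤ := measure_ball_lt_top.ne
  rw [← ENNReal.ofReal_toReal (hCb.measure_lt_top (μ := volume)).ne, ← ENNReal.ofReal_toReal hVt,
    ← ENNReal.ofReal_toReal hvt, ENNReal.ofReal_rpow_of_nonneg (by positivity) (by positivity),
    ENNReal.ofReal_rpow_of_nonneg (by positivity) hs.le, ← ENNReal.ofReal_natCast,
    ← ENNReal.ofReal_mul (by positivity), ← ENNReal.ofReal_mul (by positivity),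
    ← ENNReal.ofReal_mul (by positivity), ← ENNReal.ofReal_add (by positivity) (by positivity)]
  refine ENNReal.ofReal_le_ofReal (le_trans ?_ key)
  set V := (volume A).toReal
  have hV : 0 ≤ V := ENNReal.toReal_nonneg
  set w := (volume (Metric.ball (0 : Eucl N) 1)).toReal ^ (1 / (N : ℝ))
  obtain ⟨n, rfl⟩ : ∃ n, N = n + 1 := ⟨N - 1, by lia⟩
  -- Only the terms of order zero and one in `ε` of the binomial expansion are kept.
  refine le_trans (le_of_eq ?_)
    (pow_add_mul_le_add_pow (a := V ^ (1 / ((n + 1 : ℕ) : ℝ))) (b := ε * w)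
      (by positivity) (by positivity) (n + 1))
  have hn : ((n + 1 : ℕ) : ℝ) ≠ 0 := by positivity
  rw [Nat.add_sub_cancel, ← Real.rpow_natCast, ← Real.rpow_natCast, ← Real.rpow_mul hV,
    ← Real.rpow_mul hV, one_div_mul_cancel hn, Real.rpow_one]
  have : 1 / ((n + 1 : ℕ) : ℝ) * n = 1 - 1 / ((n + 1 : ℕ) : ℝ) := by
    field_simp
    push_cast
    ring
  rw [this]
  push_cast
  ring

/-! ### Comparison of integrals of monotone functions -/

/-- Inside `(0, ∞)` an upper set is empty or a ray, open or closed. As `σ` has no atoms, the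
endpoint does not matter. -/
theorem measure_le_of_isUpperSet {σ ρ : Measure ℝ} [NullSingletonClass σ] (hσ0 : σ (Iic 0) = 0)
    (h : ∀ a, 0 ≤ a → σ (Ioi a) ≤ ρ (Ioi a)) {U : Set ℝ} (hU : IsUpperSet U) : σ U ≤ ρ U := by
  have h0 : σ U ≤ σ (U ∩ Ioi 0) := by
    refine (measure_mono (t := (U ∩ Ioi 0) ∪ Iic 0) ?_).trans
      ((measure_union_le _ _).trans (by rw [hσ0, add_zero]))
    intro x hx
    rcases lt_or_ge 0 x with h | h
    exacts [Or.inl ⟨hx, h⟩, Or.inr h]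
  refine h0.trans ?_
  rcases (U ∩ Ioi 0).eq_empty_or_nonempty with he | hne
  · simp [he]
  have hbdd : BddBelow (U ∩ Ioi 0) := ⟨0, fun x hx => hx.2.le⟩
  set a := sInf (U ∩ Ioi 0)
  have ha : 0 ≤ a := le_csInf hne fun x hx => hx.2.le
  have h1 : U ∩ Ioi 0 ⊆ Ici a := fun x hx => csInf_le hbdd hx
  have h2 : Ioi a ⊆ U := by
    intro x hx
    obtain ⟨y, hy, hyx⟩ := exists_lt_of_csInf_lt hne hx
    exact hU hyx.le hy.1
  calc σ (U ∩ Ioi 0) ≤ σ (Ici a) := measure_mono h1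
    _ = σ (Ioi a) := (measure_congr Ioi_ae_eq_Ici).symm
    _ ≤ ρ (Ioi a) := h a ha
    _ ≤ ρ U := measure_mono h2

/-- By the layer-cake formula, since the superlevel sets of a monotone function are upper sets.
Truncation at `k` makes the function real-valued, and monotone convergence removes it. -/
theorem lintegral_le_of_monotone {σ ρ : Measure ℝ} [NullSingletonClass σ] (hσ0 : σ (Iic 0) = 0)
    (h : ∀ a, 0 ≤ a → σ (Ioi a) ≤ ρ (Ioi a)) {f : ℝ → ℝ≥0∞} (hf : Monotone f) :
    ∫⁻ t, f t ∂σ ≤ ∫⁻ t, f t ∂ρ := by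
  have hk : ∀ (k : ℕ) (τ : Measure ℝ), ∫⁻ t, min (f t) k ∂τ =
      ∫⁻ s in Ioi (0 : ℝ), τ {t | s < (min (f t) k).toReal} := by
    intro k τ
    rw [← lintegral_eq_lintegral_meas_lt τ (Filter.Eventually.of_forall
      fun t => ENNReal.toReal_nonneg)]
    · refine lintegral_congr fun t => (ENNReal.ofReal_toReal ?_).symm
      exact ((min_le_right _ _).trans_lt (ENNReal.natCast_lt_top k)).ne
    · exact (hf.measurable.min measurable_const).ennreal_toReal.aemeasurable
  have hmono : ∀ k : ℕ, Monotone fun t => (min (f t) k).toReal := fun k s t hst =>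
    ENNReal.toReal_mono ((min_le_right _ _).trans_lt (ENNReal.natCast_lt_top k)).ne
      (min_le_min_right _ (hf hst))
  have hle : ∀ k : ℕ, ∫⁻ t, min (f t) k ∂σ ≤ ∫⁻ t, min (f t) k ∂ρ := by
    intro k
    rw [hk, hk]
    refine lintegral_mono fun s => measure_le_of_isUpperSet hσ0 h ?_
    exact fun x y hxy (hx : s < _) => lt_of_lt_of_le hx (hmono k hxy)
  have hsup : ∀ t, f t = ⨆ k : ℕ, min (f t) k := by
    intro t
    have : (⨆ k : ℕ, min (f t) (k : ℝ≥0∞)) = min (f t) (⨆ k : ℕ, (k : ℝ≥0∞)) :=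
      (inf_iSup_eq (f t) fun k : ℕ => (k : ℝ≥0∞)).symm
    rw [this, ENNReal.iSup_natCast, min_top_right]
  have hlim : ∀ τ : Measure ℝ, ∫⁻ t, f t ∂τ = ⨆ k : ℕ, ∫⁻ t, min (f t) k ∂τ := by
    intro τ
    rw [← lintegral_iSup (fun k => hf.measurable.min measurable_const)]
    · exact lintegral_congr hsup
    · intro i j hij t
      exact min_le_min_left _ (by exact_mod_cast hij)
  rw [hlim, hlim]
  exact iSup_mono hle

theorem lintegral_Ioi_measure_lt {X : Type*} [MeasurableSpace X] (m : Measure X) {F : X → ℝ}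
    (hF : AEMeasurable F m) (a : ℝ) :
    ∫⁻ t in Ioi a, m {x | t < F x} = ∫⁻ x, ENNReal.ofReal (F x - a) ∂m := by
  have h1 : ∀ x, ENNReal.ofReal (F x - a) = ENNReal.ofReal (max (F x - a) 0) := fun x => by
    rw [ENNReal.ofReal_max, ENNReal.ofReal_zero, max_eq_left (zero_le)]
  simp_rw [h1]
  rw [lintegral_eq_lintegral_meas_lt m (f := fun x => max (F x - a) 0)
    (Filter.Eventually.of_forall fun x => le_max_right _ _) ((hF.sub_const a).max aemeasurable_const),
    ← lintegral_indicator measurableSet_Ioi, ← lintegral_indicator measurableSet_Ioi,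
    ← lintegral_add_right_eq_self _ a]
  refine lintegral_congr fun t => ?_
  by_cases ht : 0 < t
  · rw [indicator_of_mem (by simpa using ht), indicator_of_mem (by simpa using ht)]
    congr 1
    ext x
    simp [lt_sub_iff_add_lt, ht.not_gt]
  · rw [indicator_of_notMem (by simpa using ht), indicator_of_notMem (by simpa using ht)]

/-! ### The isoperimetric inequality for functions -/

section Isoperimetric

variable {N : ℕ} {φ : Eucl N → ℝ}

/-- For `t > a` and small `ε`, the `ε`-thickening of `{|φ| > t}` lies in `{|φ| ≥ a'}` and in `{|φ| +
ε (|∇φ| + δ) > t}`. Insert this into the isoperimetric inequality and integrate over `t > a`: the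
terms of order zero on the two sides are equal and finite, so they cancel. Divide by `ε` and let `δ
→ 0`. The gap `a' < a` leaves room for the thickening, and `a' > 0` keeps everything in the support
of `φ`. -/
theorem lintegral_Ioi_rpow_le_of_lt (hN : 2 ≤ N) (hφ : ContDiff ℝ 1 φ) (hc : HasCompactSupport φ)
    {a' a : ℝ} (ha' : 0 < a') (haa : a' < a) :
    N * volume (Metric.ball (0 : Eucl N) 1) ^ (1 / (N : ℝ)) *
      ∫⁻ t in Ioi a, volume {x | t < |φ x|} ^ (1 - 1 / (N : ℝ)) ≤
      ∫⁻ x in {x | a' ≤ |φ x|}, ‖fderiv ℝ φ x‖ₑ := by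
  set S := {x | a' ≤ |φ x|}
  set c : ℝ≥0∞ := N * volume (Metric.ball (0 : Eucl N) 1) ^ (1 / (N : ℝ))
  have hφc : Continuous φ := hφ.continuous
  have hDc : Continuous (fderiv ℝ φ) := hφ.continuous_fderiv one_ne_zero
  have hSm : MeasurableSet S := measurableSet_le measurable_const hφc.abs.measurable
  have hsub : ∀ t > 0, {x | t < |φ x|} ⊆ tsupport φ := by
    intro t ht x hx
    refine subset_tsupport _ ?_
    simpa using (ht.trans hx)
  have hSb : S ⊆ tsupport φ := by
    intro x hx
    refine subset_tsupport _ ?_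
    simpa using (ha'.trans_le hx)
  have hSf : volume S < ⊤ := (measure_mono hSb).trans_lt hc.isCompact.measure_lt_top
  have hμm : Measurable fun t : ℝ => volume {x | t < |φ x|} :=
    Antitone.measurable fun s t hst => measure_mono fun x hx => lt_of_le_of_lt hst hx
  have key : ∀ δ : ℝ, 0 < δ → c * ∫⁻ t in Ioi a, volume {x | t < |φ x|} ^ (1 - 1 / (N : ℝ)) ≤
      (∫⁻ x in S, ‖fderiv ℝ φ x‖ₑ) + ENNReal.ofReal δ * volume S := by
    intro δ hδ
    have huc := hc.uniformContinuous_of_continuous hφc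
    have huD := (hc.fderiv (𝕜 := ℝ)).uniformContinuous_of_continuous hDc
    obtain ⟨ε₁, hε₁, h₁⟩ := Metric.uniformContinuous_iff.1 huc (a - a') (by linarith)
    obtain ⟨ε₂, hε₂, h₂⟩ := Metric.uniformContinuous_iff.1 huD δ hδ
    set ε := min ε₁ ε₂
    have hε : 0 < ε := lt_min hε₁ hε₂
    set F : Eucl N → ℝ := fun x => |φ x| + ε * (‖fderiv ℝ φ x‖ + δ)
    have hFm : Measurable F := by
      have : Continuous F := by fun_prop
      exact this.measurable
    have hincl : ∀ t > a, Metric.thickening ε {x | t < |φ x|} ⊆ S ∩ {x | t < F x} := by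
      intro t ht x hx
      obtain ⟨y, hy, hxy⟩ := Metric.mem_thickening_iff.1 hx
      rw [mem_ofPred_eq] at hy
      have hxy1 : |φ x - φ y| < a - a' := h₁ (hxy.trans_le (min_le_left _ _))
      have hbd : ‖φ y - φ x‖ ≤ (‖fderiv ℝ φ x‖ + δ) * ‖y - x‖ := by
        refine (convex_ball x ε).norm_image_sub_le_of_norm_fderiv_le (𝕜 := ℝ)
          (fun z _ => (hφ.differentiable one_ne_zero) z) (fun z hz => ?_)
          (Metric.mem_ball_self hε) (by rwa [Metric.mem_ball, dist_comm])
        have h3 : dist (fderiv ℝ φ z) (fderiv ℝ φ x) < δ :=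
          h₂ (lt_of_lt_of_le hz (min_le_right _ _))
        rw [dist_eq_norm] at h3
        have := norm_le_norm_add_norm_sub (fderiv ℝ φ x) (fderiv ℝ φ z)
        rw [norm_sub_rev] at this
        linarith
      have h4 : |φ y| ≤ |φ x| + |φ y - φ x| := by
        have := abs_sub_abs_le_abs_sub (φ y) (φ x)
        linarith
      constructor
      · rw [abs_sub_comm] at hxy1
        rw [mem_ofPred_eq]
        linarith
      · rw [mem_ofPred_eq]
        rw [Real.norm_eq_abs] at hbd
        rw [dist_comm, dist_eq_norm] at hxy
        have : (‖fderiv ℝ φ x‖ + δ) * ‖y - x‖ ≤ (‖fderiv ℝ φ x‖ + δ) * ε := by gcongr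
        simp only [F]
        linarith
    have hle : ∀ t ∈ Ioi a, volume {x | t < |φ x|} +
        ENNReal.ofReal ε * (c * volume {x | t < |φ x|} ^ (1 - 1 / (N : ℝ))) ≤
        (volume.restrict S) {x | t < F x} := by
      intro t ht
      have ht0 : 0 < t := ha'.trans (haa.trans ht)
      refine (volume_add_le_volume_thickening hN (isOpen_lt continuous_const hφc.abs)
        (hc.isCompact.isBounded.subset (hsub t ht0)) hε).trans ?_
      rw [Measure.restrict_apply (measurableSet_lt measurable_const hFm), inter_comm]
      exact measure_mono (hincl t ht)
    have hint := setLIntegral_mono' (μ := volume) measurableSet_Ioi hle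
    rw [lintegral_add_left hμm, lintegral_const_mul _ ((hμm.pow_const _).const_mul _),
      lintegral_const_mul _ (hμm.pow_const _), lintegral_Ioi_measure_lt _ hFm.aemeasurable] at hint
    have hμS : ∫⁻ t in Ioi a, volume {x | t < |φ x|} = ∫⁻ x in S, ENNReal.ofReal (|φ x| - a) := by
      rw [← lintegral_Ioi_measure_lt _ hφc.abs.measurable.aemeasurable]
      refine setLIntegral_congr_fun measurableSet_Ioi fun t ht => ?_
      rw [Measure.restrict_apply (measurableSet_lt measurable_const hφc.abs.measurable),
        inter_eq_left.2]
      intro x hx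
      exact (haa.trans (lt_trans ht hx)).le
    have hfin : ∫⁻ x in S, ENNReal.ofReal (|φ x| - a) ≠ ⊤ := by
      obtain ⟨C, hC⟩ := hc.exists_bound_of_continuous hφc
      refine ((setLIntegral_mono (g := fun _ => ENNReal.ofReal C) measurable_const
        fun x _ => ENNReal.ofReal_le_ofReal ?_).trans_lt ?_).ne
      · have := hC x
        rw [Real.norm_eq_abs] at this
        linarith
      · rw [setLIntegral_const]
        exact ENNReal.mul_lt_top ENNReal.ofReal_lt_top hSf
    have hF : ∫⁻ x in S, ENNReal.ofReal (F x - a) ≤ (∫⁻ x in S, ENNReal.ofReal (|φ x| - a)) +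
        ENNReal.ofReal ε * ((∫⁻ x in S, ‖fderiv ℝ φ x‖ₑ) + ENNReal.ofReal δ * volume S) := by
      rw [← setLIntegral_const, ← lintegral_add_right _ measurable_const,
        ← lintegral_const_mul _ (by fun_prop), ← lintegral_add_right _ (by fun_prop)]
      refine lintegral_mono fun x => ?_
      rw [← ofReal_norm, ← ENNReal.ofReal_add (norm_nonneg _) hδ.le,
        ← ENNReal.ofReal_mul hε.le]
      refine le_trans (ENNReal.ofReal_le_ofReal (le_of_eq ?_)) ENNReal.ofReal_add_le
      simp only [F]
      ring
    rw [hμS] at hint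
    have h5 := (ENNReal.add_le_add_iff_left hfin).1 (hint.trans hF)
    exact (ENNReal.mul_le_mul_iff_right (by simpa using hε) ENNReal.ofReal_ne_top).1 h5
  refine ge_of_tendsto (x := nhdsWithin (0 : ℝ) (Ioi 0))
    (f := fun δ : ℝ => (∫⁻ x in S, ‖fderiv ℝ φ x‖ₑ) + ENNReal.ofReal δ * volume S) ?_
    (eventually_nhdsWithin_of_forall fun δ hδ => key δ hδ)
  have : Filter.Tendsto (fun δ : ℝ => ENNReal.ofReal δ * volume S) (nhdsWithin 0 (Ioi 0))
      (nhds (ENNReal.ofReal 0 * volume S)) :=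
    ENNReal.Tendsto.mul_const ((ENNReal.continuous_ofReal.tendsto 0).mono_left nhdsWithin_le_nhds)
      (Or.inr hSf.ne)
  simpa using this.const_add (∫⁻ x in S, ‖fderiv ℝ φ x‖ₑ)

/-- The rays above `u n` increase to the ray above `a`, and the midpoint of `a` and `u n` serves as
the lower level, which is positive. -/
theorem lintegral_Ioi_rpow_le (hN : 2 ≤ N) (hφ : ContDiff ℝ 1 φ) (hc : HasCompactSupport φ)
    {a : ℝ} (ha : 0 ≤ a) :
    N * volume (Metric.ball (0 : Eucl N) 1) ^ (1 / (N : ℝ)) *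
      ∫⁻ t in Ioi a, volume {x | t < |φ x|} ^ (1 - 1 / (N : ℝ)) ≤
      ∫⁻ x in {x | a < |φ x|}, ‖fderiv ℝ φ x‖ₑ := by
  obtain ⟨u, hu, hu', hlim⟩ := exists_seq_strictAnti_tendsto a
  have hU : Ioi a = ⋃ n, Ioi (u n) := by
    ext t
    simp only [mem_Ioi, mem_iUnion]
    constructor
    · intro ht
      exact (hlim.eventually (gt_mem_nhds ht)).exists
    · rintro ⟨n, hn⟩
      exact (hu' n).trans hn
  have hdir : Directed (· ⊆ ·) fun n => Ioi (u n) :=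
    Monotone.directed_le fun m n hmn => Ioi_subset_Ioi (hu.antitone hmn)
  rw [hU, setLIntegral_iUnion_of_directed _ hdir, ENNReal.mul_iSup]
  refine iSup_le fun n => ?_
  refine (lintegral_Ioi_rpow_le_of_lt hN hφ hc (a' := (a + u n) / 2) (a := u n)
    (by linarith [hu' n]) (by linarith [hu' n])).trans (lintegral_mono_set ?_)
  intro x hx
  rw [mem_ofPred_eq] at hx ⊢
  linarith [hu' n]

/-- The isoperimetric inequality for functions, weighted by a monotone function of the level. -/
theorem lintegral_mul_rpow_le (hN : 2 ≤ N) (hφ : ContDiff ℝ 1 φ) (hc : HasCompactSupport φ)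
    {f : ℝ → ℝ≥0∞} (hf : Monotone f) :
    N * volume (Metric.ball (0 : Eucl N) 1) ^ (1 / (N : ℝ)) *
      ∫⁻ t in Ioi 0, f t * volume {x | t < |φ x|} ^ (1 - 1 / (N : ℝ)) ≤
      ∫⁻ x, f |φ x| * ‖fderiv ℝ φ x‖ₑ := by
  set c : ℝ≥0∞ := N * volume (Metric.ball (0 : Eucl N) 1) ^ (1 / (N : ℝ))
  have hφc : Continuous φ := hφ.continuous
  have hDc : Continuous (fderiv ℝ φ) := hφ.continuous_fderiv one_ne_zero
  have hμ : Measurable fun t : ℝ => volume {x | t < |φ x|} :=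
    Antitone.measurable fun s t hst => measure_mono fun x hx => lt_of_le_of_lt hst hx
  have hμm : Measurable fun t : ℝ => volume {x | t < |φ x|} ^ (1 - 1 / (N : ℝ)) := hμ.pow_const _
  -- Both sides are integrals of `f` over the line, against `σ` and against the image `ρ` of `|∇φ|
  -- dx` under `|φ|`. The unweighted inequality compares them on rays, and monotonicity of `f` does
  -- the rest.
  set σ : Measure ℝ := (volume.restrict (Ioi 0)).withDensity
    fun t => c * volume {x | t < |φ x|} ^ (1 - 1 / (N : ℝ)) with hσ
  have hfφ : Measurable fun x => f |φ x| := hf.measurable.comp hφc.abs.measurable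
  set ρ : Measure ℝ := (volume.withDensity fun x => ‖fderiv ℝ φ x‖ₑ).map fun x => |φ x| with hρ
  have hac : σ ≪ volume :=
    (withDensity_absolutelyContinuous _ _).trans Measure.absolutelyContinuous_restrict
  have : NullSingletonClass σ := ⟨fun x => hac (measure_singleton x)⟩
  have hσ0 : σ (Iic 0) = 0 := by
    refine withDensity_absolutelyContinuous _ _ ?_
    rw [Measure.restrict_apply measurableSet_Iic, Iic_inter_Ioi, Ioc_self, measure_empty]
  have key := lintegral_le_of_monotone (σ := σ) (ρ := ρ) hσ0 ?_ hf
  · rw [hσ, hρ, lintegral_map hf.measurable hφc.abs.measurable,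
      lintegral_withDensity_eq_lintegral_mul _ (hμm.const_mul _) hf.measurable,
      lintegral_withDensity_eq_lintegral_mul _ (by fun_prop) hfφ] at key
    rw [← lintegral_const_mul _ (by exact hf.measurable.mul hμm)]
    convert key using 1
    · refine lintegral_congr fun t => ?_
      simp only [Pi.mul_apply]
      ring
    · refine lintegral_congr fun x => ?_
      simp only [Pi.mul_apply]
      ring
  · intro a ha
    rw [hσ, hρ, withDensity_apply _ measurableSet_Ioi,
      Measure.restrict_restrict measurableSet_Ioi, Ioi_inter_Ioi, sup_of_le_left ha,
      lintegral_const_mul _ hμm, Measure.map_apply hφc.abs.measurable measurableSet_Ioi,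
      withDensity_apply _ (hφc.abs.measurable measurableSet_Ioi)]
    exact lintegral_Ioi_rpow_le hN hφ hc ha

end Isoperimetric

/-! ### Weighted inequalities for weights in weak Lebesgue spaces -/

section Weak

variable {X : Type*} [MeasurableSpace X] {m : Measure X} {ψ : X → ℝ} {K r : ℝ}

/-- The distribution function of `ψ` on `E` is at most both `m E` and `(K / s) ^ r`. The layer-cake
integral is split at `s₀`, where the two bounds agree. -/
theorem setLIntegral_sq_le_of_weak (hr : 2 < r) (hK : 0 < K) (hψ : AEMeasurable ψ m)
    (hψ0 : ∀ x, 0 ≤ ψ x) (hw : ∀ s, 0 < s → m {x | s < ψ x} ≤ ENNReal.ofReal ((K / s) ^ r))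
    {E : Set X} (hE : m E ≠ ⊤) :
    ∫⁻ x in E, ENNReal.ofReal (ψ x ^ 2) ∂m ≤
      ENNReal.ofReal (K ^ 2 * (r / (r - 2))) * m E ^ (1 - 2 / r) := by
  rcases eq_or_ne (m E) 0 with hE0 | hE0
  · rw [setLIntegral_measure_zero _ _ hE0]
    exact zero_le
  set V := (m E).toReal
  have hV : 0 < V := ENNReal.toReal_pos hE0 hE
  have hr0 : 0 < r := by linarith
  have hr2 : 0 < r - 2 := by linarith
  have hEV : m E = ENNReal.ofReal V := (ENNReal.ofReal_toReal hE).symm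
  set s₀ := K * V ^ (-(1 / r))
  have hs₀ : 0 < s₀ := by positivity
  have h1 : ∀ x, ENNReal.ofReal (ψ x ^ 2) = ENNReal.ofReal (ψ x ^ (2 : ℝ)) := fun x => by
    rw [Real.rpow_two]
  simp_rw [h1]
  rw [lintegral_rpow_eq_lintegral_meas_lt_mul _ (Filter.Eventually.of_forall hψ0) hψ.restrict
    two_pos, ← Ioc_union_Ioi_eq_Ioi hs₀.le,
    lintegral_union measurableSet_Ioi (Ioc_disjoint_Ioi le_rfl)]
  have hA : ∫⁻ s in Ioc 0 s₀, (m.restrict E) {x | s < ψ x} * ENNReal.ofReal (s ^ ((2 : ℝ) - 1)) ≤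
      ENNReal.ofReal (V * (s₀ ^ 2 / 2)) := by
    calc _ ≤ ∫⁻ s in Ioc 0 s₀, ENNReal.ofReal (V * s) := by
          refine setLIntegral_mono' measurableSet_Ioc fun s hs => ?_
          rw [ENNReal.ofReal_mul hV.le, ← hEV]
          norm_num
          refine mul_le_mul' ?_ le_rfl
          exact (measure_mono (subset_univ _)).trans (Measure.restrict_apply_univ E).le
      _ = ENNReal.ofReal (∫ s in Ioc 0 s₀, V * s) := by
          rw [ofReal_integral_eq_lintegral_ofReal]
          · exact ((continuous_const.mul continuous_id).integrableOn_Icc).mono_set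
              Ioc_subset_Icc_self
          · filter_upwards [self_mem_ae_restrict measurableSet_Ioc] with s hs
            exact mul_nonneg hV.le hs.1.le
      _ = _ := by
          rw [← intervalIntegral.integral_of_le hs₀.le, intervalIntegral.integral_const_mul,
            integral_id]
          norm_num
  have hB : ∫⁻ s in Ioi s₀, (m.restrict E) {x | s < ψ x} * ENNReal.ofReal (s ^ ((2 : ℝ) - 1)) ≤
      ENNReal.ofReal (K ^ r * (s₀ ^ (2 - r) / (r - 2))) := by
    calc _ ≤ ∫⁻ s in Ioi s₀, ENNReal.ofReal (K ^ r * s ^ (1 - r)) := by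
          refine setLIntegral_mono' measurableSet_Ioi fun s hs => ?_
          have hs' : 0 < s := hs₀.trans hs
          calc _ ≤ ENNReal.ofReal ((K / s) ^ r) * ENNReal.ofReal (s ^ ((2 : ℝ) - 1)) := by
                gcongr
                exact (Measure.restrict_apply_le _ _).trans (hw s hs')
            _ = _ := by
                rw [← ENNReal.ofReal_mul (by positivity)]
                congr 1
                rw [Real.div_rpow hK.le hs'.le, Real.rpow_sub hs' 1 r, Real.rpow_one]
                norm_num
                ring
      _ = ENNReal.ofReal (∫ s in Ioi s₀, K ^ r * s ^ (1 - r)) := by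
          rw [ofReal_integral_eq_lintegral_ofReal]
          · exact (integrableOn_Ioi_rpow_of_lt (by linarith) hs₀).const_mul _
          · filter_upwards [self_mem_ae_restrict measurableSet_Ioi] with s hs
            have hs' : 0 < s := hs₀.trans hs
            positivity
      _ = _ := by
          rw [integral_const_mul, integral_Ioi_rpow_of_lt (by linarith) hs₀]
          congr 2
          rw [show 1 - r + 1 = 2 - r by ring, ← neg_sub r 2, div_neg, neg_div, neg_neg]
  refine (mul_le_mul_right (add_le_add hA hB) _).trans ?_
  rw [← ENNReal.ofReal_add (by positivity) (by positivity), ← ENNReal.ofReal_mul (by norm_num), hEV,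
    ENNReal.ofReal_rpow_of_pos hV, ← ENNReal.ofReal_mul (by positivity)]
  refine ENNReal.ofReal_le_ofReal (le_of_eq ?_)
  have e1 : V * s₀ ^ 2 = K ^ 2 * V ^ (1 - 2 / r) := by
    rw [mul_pow, ← Real.rpow_natCast (V ^ _), ← Real.rpow_mul hV.le, mul_left_comm]
    congr 1
    nth_rw 1 [← Real.rpow_one V]
    rw [← Real.rpow_add hV]
    congr 1
    push_cast
    ring
  have e2 : K ^ r * s₀ ^ (2 - r) = K ^ 2 * V ^ (1 - 2 / r) := by
    rw [Real.mul_rpow hK.le (by positivity), ← Real.rpow_mul hV.le, ← mul_assoc,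
      ← Real.rpow_add hK, add_sub_cancel, Real.rpow_two]
    congr 2
    field_simp
    ring
  calc 2 * (V * (s₀ ^ 2 / 2) + K ^ r * (s₀ ^ (2 - r) / (r - 2)))
      = V * s₀ ^ 2 + 2 / (r - 2) * (K ^ r * s₀ ^ (2 - r)) := by ring
    _ = _ := by
      rw [e1, e2]
      field_simp
      ring

/-- Layer cake for `f ^ 2` with respect to the measure `ψ ^ 2 dm`, whose value on each superlevel
set of `f` is controlled by the preceding estimate. -/
theorem lintegral_sq_mul_sq_le_of_weak (hr : 2 < r) (hK : 0 < K) (hψ : AEMeasurable ψ m)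
    (hψ0 : ∀ x, 0 ≤ ψ x) (hw : ∀ s, 0 < s → m {x | s < ψ x} ≤ ENNReal.ofReal ((K / s) ^ r))
    {f : X → ℝ} (hf : Measurable f) (hf0 : ∀ x, 0 ≤ f x) (hfin : ∀ t, 0 < t → m {x | t < f x} ≠ ⊤) :
    ∫⁻ x, ENNReal.ofReal (ψ x ^ 2) * ENNReal.ofReal (f x ^ 2) ∂m ≤
      ENNReal.ofReal (K ^ 2 * (r / (r - 2))) *
        (2 * ∫⁻ t in Ioi 0, ENNReal.ofReal t * m {x | t < f x} ^ (1 - 2 / r)) := by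
  have hm : AEMeasurable (fun x => ENNReal.ofReal (ψ x ^ 2)) m := (hψ.pow_const 2).ennreal_ofReal
  have hfm : Measurable fun x => ENNReal.ofReal (f x ^ 2) := (hf.pow_const 2).ennreal_ofReal
  have hμ : Measurable fun t : ℝ => m {x | t < f x} :=
    Antitone.measurable fun s t hst => measure_mono fun x hx => lt_of_le_of_lt hst hx
  have h1 : ∀ x, ENNReal.ofReal (f x ^ 2) = ENNReal.ofReal (f x ^ (2 : ℝ)) := fun x => by
    rw [Real.rpow_two]
  have h2 := lintegral_withDensity_eq_lintegral_mul₀ hm hfm.aemeasurable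
  simp only [Pi.mul_apply] at h2
  rw [← h2]
  simp_rw [h1]
  rw [lintegral_rpow_eq_lintegral_meas_lt_mul _ (Filter.Eventually.of_forall hf0) hf.aemeasurable
    two_pos, ENNReal.ofReal_ofNat, mul_left_comm]
  gcongr
  rw [← lintegral_const_mul _ (by exact ENNReal.measurable_ofReal.mul (hμ.pow_const _))]
  refine setLIntegral_mono' measurableSet_Ioi fun t ht => ?_
  rw [withDensity_apply _ (measurableSet_lt measurable_const hf), ← mul_assoc, mul_right_comm]
  norm_num
  gcongr
  exact setLIntegral_sq_le_of_weak hr hK hψ hψ0 hw (hfin t ht)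

end Weak

/-! ### The sharp Lorentz–Sobolev inequality and Alvino's inequality -/

section Sobolev

variable {N : ℕ} {φ : Eucl N → ℝ}

/-- `∫₀^∞ t |{|φ| > t}|^{1 - 2/N} dt`, which is half the square of the Lorentz norm of `φ` in
`L^{2N/(N-2),2}`. -/
def lorentzIntegral (φ : Eucl N → ℝ) : ℝ≥0∞ :=
  ∫⁻ t in Ioi (0 : ℝ), ENNReal.ofReal t * volume {x | t < |φ x|} ^ (1 - 2 / (N : ℝ))

theorem volume_lt_abs_lt_top (hc : HasCompactSupport φ) {t : ℝ} (ht : 0 < t) :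
    volume {x | t < |φ x|} < ⊤ := by
  refine (measure_mono fun x hx => ?_).trans_lt hc.isCompact.measure_lt_top
  refine subset_tsupport _ ?_
  simpa using (ht.trans hx)

/-- Finiteness is what later allows a factor of this integral to be cancelled. -/
theorem lorentzIntegral_ne_top (hN : 2 < N) (hφ : Continuous φ) (hc : HasCompactSupport φ) :
    lorentzIntegral φ ≠ ⊤ := by
  have hN' : (2 : ℝ) < N := by exact_mod_cast hN
  have hs : 0 < 1 - 2 / (N : ℝ) := by
    rw [sub_pos, div_lt_one] <;> linarith
  obtain ⟨C, hC⟩ := hc.exists_bound_of_continuous hφ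
  have hC0 : 0 ≤ C := (norm_nonneg _).trans (hC 0)
  have hV : volume (tsupport φ) < ⊤ := hc.isCompact.measure_lt_top
  have hle : ∀ t ∈ Ioi (0 : ℝ), ENNReal.ofReal t * volume {x | t < |φ x|} ^ (1 - 2 / (N : ℝ)) ≤
      (Iic C).indicator (fun _ => ENNReal.ofReal C * volume (tsupport φ) ^ (1 - 2 / (N : ℝ))) t := by
    intro t ht
    by_cases htC : t ≤ C
    · rw [indicator_of_mem (by exact htC)]
      gcongr
      intro x hx
      refine subset_tsupport _ ?_
      simpa using (lt_trans ht (show t < |φ x| from hx))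
    · have : {x | t < |φ x|} = ∅ := by
        ext x
        simpa using (hC x).trans (not_le.1 htC).le
      rw [this, measure_empty, ENNReal.zero_rpow_of_pos hs, mul_zero]
      exact zero_le
  refine ((setLIntegral_mono' measurableSet_Ioi hle).trans_lt ?_).ne
  rw [lintegral_indicator measurableSet_Iic, lintegral_const, Measure.restrict_restrict
    measurableSet_Iic, Measure.restrict_apply_univ, Iic_inter_Ioi, Real.volume_Ioc]
  exact ENNReal.mul_lt_top (ENNReal.mul_lt_top ENNReal.ofReal_lt_top
    (ENNReal.rpow_lt_top_of_nonneg hs.le hV.ne)) ENNReal.ofReal_lt_top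

/-- The weight `|{|φ| ≥ |φ x|}|^{-1/N}` has weak `L^N` norm at most `1`. -/
theorem volume_level_weight_le (hN : N ≠ 0) (φ : Eucl N → ℝ) {s : ℝ} (hs : 0 < s) :
    volume {x | ENNReal.ofReal s < volume {y | |φ x| ≤ |φ y|} ^ (-(1 / (N : ℝ)))} ≤
      ENNReal.ofReal ((1 / s) ^ (N : ℝ)) := by
  set c := ENNReal.ofReal ((1 / s) ^ (N : ℝ))
  have hN' : (0 : ℝ) < N := by positivity
  have hx : ∀ x, ENNReal.ofReal s < volume {y | |φ x| ≤ |φ y|} ^ (-(1 / (N : ℝ))) →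
      volume {y | |φ x| ≤ |φ y|} ≤ c := by
    intro x hx
    rw [ENNReal.rpow_neg, ENNReal.lt_inv_iff_lt_inv] at hx
    have := ENNReal.rpow_le_rpow hx.le hN'.le
    rwa [← ENNReal.rpow_mul, one_div_mul_cancel hN'.ne', ENNReal.rpow_one,
      ← ENNReal.ofReal_inv_of_pos hs, ENNReal.ofReal_rpow_of_nonneg (by positivity) hN'.le,
      ← one_div] at this
  set W := {x | ENNReal.ofReal s < volume {y | |φ x| ≤ |φ y|} ^ (-(1 / (N : ℝ)))}
  rcases W.eq_empty_or_nonempty with hW | hW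
  · rw [hW, measure_empty]
    exact zero_le
  set A := (fun x => |φ x|) '' W
  have hA : A.Nonempty := hW.image _
  have hAb : BddBelow A := ⟨0, by rintro _ ⟨x, -, rfl⟩; exact abs_nonneg _⟩
  -- `W` lies in the superlevel set at the infimum of `|φ|` over `W`. If the infimum is attained,
  -- that set has volume at most `c`. Otherwise `W` is covered by an increasing union of superlevel
  -- sets at attained values.
  by_cases hmem : sInf A ∈ A
  · obtain ⟨x, hxW, hxA⟩ := hmem
    refine (measure_mono fun y hy => ?_).trans (hx x hxW)
    simp only at hxA
    rw [mem_ofPred_eq, hxA]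
    exact csInf_le hAb (mem_image_of_mem _ hy)
  · obtain ⟨u, hu, -, hlim, huA⟩ := (isGLB_csInf hA hAb).exists_seq_strictAnti_tendsto_of_notMem
      hmem hA
    have hcov : W ⊆ ⋃ n, {y | u n ≤ |φ y|} := by
      intro y hy
      have h1 : sInf A < |φ y| := lt_of_le_of_ne (csInf_le hAb (mem_image_of_mem _ hy))
        fun h => hmem (h ▸ mem_image_of_mem _ hy)
      obtain ⟨n, hn⟩ := (hlim.eventually (gt_mem_nhds h1)).exists
      exact mem_iUnion.2 ⟨n, hn.le⟩
    refine (measure_mono hcov).trans ?_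
    rw [Directed.measure_iUnion]
    · refine iSup_le fun n => ?_
      obtain ⟨x, hxW, hxu⟩ := huA n
      simp only at hxu
      rw [← hxu]
      exact hx x hxW
    · exact Monotone.directed_le fun i j hij y hy => (hu.antitone hij).trans hy

/-- The sharp Sobolev inequality in Lorentz spaces, for functions in `C_c^1`. -/
theorem lorentzIntegral_le (hN : 2 < N) (hφ : ContDiff ℝ 1 φ) (hc : HasCompactSupport φ) :
    (N * volume (Metric.ball (0 : Eucl N) 1) ^ (1 / (N : ℝ))) ^ 2 * lorentzIntegral φ ≤
      ENNReal.ofReal (N / (N - 2)) * 2 * ∫⁻ x, ‖fderiv ℝ φ x‖ₑ ^ 2 := by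
  have hN' : (2 : ℝ) < N := by exact_mod_cast hN
  have hφc : Continuous φ := hφ.continuous
  have hDc : Continuous (fderiv ℝ φ) := hφ.continuous_fderiv one_ne_zero
  have hs : 0 < 1 - 2 / (N : ℝ) := by
    rw [sub_pos, div_lt_one] <;> linarith
  set c := (N * volume (Metric.ball (0 : Eucl N) 1) ^ (1 / (N : ℝ)))
  have hs' : 0 < 1 - 1 / (N : ℝ) := by
    rw [sub_pos, div_lt_one] <;> linarith
  set D := ∫⁻ x, ‖fderiv ℝ φ x‖ₑ ^ 2
  set ν : ℝ → ℝ≥0∞ := fun t => volume {y | t ≤ |φ y|}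
  have hνa : Antitone ν := fun s t hst => measure_mono fun x hx => hst.trans hx
  have hwm : Monotone fun t => ν t ^ (-(1 / (N : ℝ))) := fun s t hst => by
    simp only [ENNReal.rpow_neg]
    exact ENNReal.inv_le_inv.2 (ENNReal.rpow_le_rpow (hνa hst) (by positivity))
  have hwφ : Measurable fun x => ν |φ x| ^ (-(1 / (N : ℝ))) :=
    hwm.measurable.comp hφc.abs.measurable
  have hfin : ∀ᵐ x, ν |φ x| ^ (-(1 / (N : ℝ))) < ⊤ := by
    rw [ae_iff]
    refine le_antisymm (ge_of_tendsto' (x := Filter.atTop)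
      (f := fun n : ℕ => ENNReal.ofReal ((1 / ((n : ℝ) + 1)) ^ (N : ℝ))) ?_ fun n => ?_) zero_le
    · have h1 := (tendsto_one_div_add_atTop_nhds_zero_nat (𝕜 := ℝ)).rpow_const
        (p := (N : ℝ)) (Or.inr (by positivity))
      rw [Real.zero_rpow (by positivity)] at h1
      simpa using ENNReal.tendsto_ofReal h1
    · refine le_trans (measure_mono fun x hx => ?_)
        (volume_level_weight_le (by lia) φ (s := (n : ℝ) + 1) (by positivity))
      rw [mem_ofPred_eq, not_lt, top_le_iff] at hx
      change _ < ν |φ x| ^ (-(1 / (N : ℝ)))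
      rw [hx]
      exact ENNReal.ofReal_lt_top
  -- Two properties dictate `h`: times `|{|φ| > t}| ^ (1 - 1/N)` it gives the integrand of the
  -- Lorentz integral for almost every level, and `h |φ|` is `|φ|` times a weight of weak `L^N` norm
  -- at most `1`. So `∫ h |φ| ^ 2` is again bounded by the Lorentz integral.
  set h : ℝ → ℝ≥0∞ := fun t => ENNReal.ofReal t * ν t ^ (-(1 / (N : ℝ)))
  have hh : Monotone h := fun s t hst =>
    mul_le_mul' (ENNReal.ofReal_le_ofReal hst) (hwm hst)
  have hhφ : Measurable fun x => h |φ x| := hh.measurable.comp hφc.abs.measurable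
  have h1 : c * lorentzIntegral φ ≤ ∫⁻ x, h |φ x| * ‖fderiv ℝ φ x‖ₑ := by
    refine le_trans (mul_le_mul_right (le_of_eq (lintegral_congr_ae ?_)) _)
      (lintegral_mul_rpow_le hN.le hφ hc hh)
    filter_upwards [meas_le_ae_eq_meas_lt volume (volume.restrict (Ioi 0)) fun x => |φ x|,
      self_mem_ae_restrict measurableSet_Ioi] with t ht ht0
    simp only [h, ν]
    rw [ht, mul_assoc]
    congr 1
    rcases eq_or_ne (volume {x | t < |φ x|}) 0 with h0 | h0
    · rw [h0, ENNReal.zero_rpow_of_pos hs, ENNReal.zero_rpow_of_pos hs', mul_zero]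
    · rw [← ENNReal.rpow_add _ _ h0 (volume_lt_abs_lt_top hc ht0).ne]
      congr 1
      ring
  have h2 : ∫⁻ x, h |φ x| * ‖fderiv ℝ φ x‖ₑ ≤
      (∫⁻ x, h |φ x| ^ (2 : ℝ)) ^ (1 / (2 : ℝ)) * (∫⁻ x, ‖fderiv ℝ φ x‖ₑ ^ (2 : ℝ)) ^ (1 / (2 : ℝ)) :=
    ENNReal.lintegral_mul_le_Lp_mul_Lq volume (Real.HolderConjugate.two_two) hhφ.aemeasurable
      (by fun_prop)
  have h3 : ∫⁻ x, h |φ x| ^ (2 : ℝ) ≤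
      ENNReal.ofReal (N / (N - 2)) * (2 * lorentzIntegral φ) := by
    have := lintegral_sq_mul_sq_le_of_weak (m := (volume : Measure (Eucl N)))
      (ψ := fun x => (ν |φ x| ^ (-(1 / (N : ℝ)))).toReal) (r := N) (K := 1) hN' one_pos
      hwφ.ennreal_toReal.aemeasurable (fun _ => ENNReal.toReal_nonneg) ?_
      (f := fun x => |φ x|) hφc.abs.measurable (fun _ => abs_nonneg _)
      (fun t ht => (volume_lt_abs_lt_top hc ht).ne)
    · rw [one_pow, one_mul] at this
      refine le_trans (lintegral_mono_ae ?_) this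
      filter_upwards [hfin] with x hx
      simp only [h]
      rw [ENNReal.rpow_two, mul_pow, ENNReal.ofReal_pow ENNReal.toReal_nonneg,
        ENNReal.ofReal_pow (abs_nonneg _), ENNReal.ofReal_toReal hx.ne, mul_comm]
    · intro s hs
      refine le_trans (measure_mono fun x hx => ?_) (volume_level_weight_le (by lia) φ hs)
      exact (ENNReal.ofReal_lt_iff_lt_toReal hs.le (by
        intro htop
        rw [mem_ofPred_eq, htop] at hx
        exact absurd hx (not_lt.2 hs.le))).2 hx
  have hI : lorentzIntegral φ ≠ ⊤ := lorentzIntegral_ne_top hN hφc hc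
  set I := lorentzIntegral φ
  rcases eq_or_ne I 0 with hI0 | hI0
  · rw [hI0, mul_zero]
    exact zero_le
  have h4 : (c * I) ^ 2 ≤ ENNReal.ofReal (N / (N - 2)) * (2 * I) * D := by
    calc (c * I) ^ 2 ≤ ((∫⁻ x, h |φ x| ^ (2 : ℝ)) ^ (1 / (2 : ℝ)) *
          (∫⁻ x, ‖fderiv ℝ φ x‖ₑ ^ (2 : ℝ)) ^ (1 / (2 : ℝ))) ^ 2 := by
            exact pow_le_pow_left' (h1.trans h2) 2
      _ = (∫⁻ x, h |φ x| ^ (2 : ℝ)) * D := by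
          rw [mul_pow, ← ENNReal.rpow_natCast, ← ENNReal.rpow_natCast, ← ENNReal.rpow_mul,
            ← ENNReal.rpow_mul]
          norm_num [D]
      _ ≤ _ := by gcongr
  -- The estimate is quadratic in `I` on the left and linear on the right, so one factor `I`
  -- cancels.
  refine (ENNReal.mul_le_mul_iff_left hI0 hI).1 ?_
  calc c ^ 2 * I * I = (c * I) ^ 2 := by ring
    _ ≤ _ := h4
    _ = _ := by ring

theorem sobolevConst_two_eq (hN : 2 < N) : sobolevConst N 2 = ENNReal.ofReal
    ((volume (Metric.ball (0 : Eucl N) 1)).toReal ^ (-(1 / (N : ℝ))) * (2 / (N - 2))) := by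
  have hN' : (0 : ℝ) < N - 2 := by
    rw [sub_pos]
    exact_mod_cast hN
  have : Nonempty (Fin N) := ⟨⟨0, by lia⟩⟩
  have hv : 0 < (volume (Metric.ball (0 : Eucl N) 1)).toReal :=
    ENNReal.toReal_pos (Metric.measure_ball_pos _ _ one_pos).ne' measure_ball_lt_top.ne
  rw [sobolevConst, ENNReal.ofReal_mul (by positivity), ← ENNReal.ofReal_rpow_of_pos hv,
    ENNReal.ofReal_toReal measure_ball_lt_top.ne, ENNReal.ofReal_div_of_pos hN',
    ENNReal.ofReal_sub _ (by norm_num)]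
  simp

/-- Alvino's inequality: multiplication by a function in weak `L^N`, with the sharp constant. -/
theorem setLIntegral_sq_mul_sq_le (hN : 2 < N) (hφ : ContDiff ℝ 1 φ) (hc : HasCompactSupport φ)
    {Ω : Set (Eucl N)} {ψ : Eucl N → ℝ} {K : ℝ} (hK : 0 < K)
    (hψ : AEMeasurable ψ (volume.restrict Ω)) (hψ0 : ∀ x, 0 ≤ ψ x)
    (hw : weakLpNorm Ω N ψ ≤ ENNReal.ofReal K) :
    ∫⁻ x in Ω, ENNReal.ofReal (ψ x ^ 2) * ENNReal.ofReal (φ x ^ 2) ≤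
      (ENNReal.ofReal K * sobolevConst N 2) ^ 2 * ∫⁻ x, ‖fderiv ℝ φ x‖ₑ ^ 2 := by
  have hN' : (2 : ℝ) < N := by exact_mod_cast hN
  have hN0 : (0 : ℝ) < N := by linarith
  have hN2 : (0 : ℝ) < N - 2 := by linarith
  have : Nonempty (Fin N) := ⟨⟨0, by lia⟩⟩
  have hv : 0 < (volume (Metric.ball (0 : Eucl N) 1)).toReal :=
    ENNReal.toReal_pos (Metric.measure_ball_pos _ _ one_pos).ne' measure_ball_lt_top.ne
  have hw' : ∀ s, 0 < s → volume.restrict Ω {x | s < ψ x} ≤ ENNReal.ofReal ((K / s) ^ (N : ℝ)) := by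
    intro s hs
    have h1 : ENNReal.ofReal s * (volume.restrict Ω {x | s < |ψ x|}) ^ (1 / (N : ℝ)) ≤
        ENNReal.ofReal K := (le_iSup₂ (f := fun (m : ℝ) (_ : 0 < m) => ENNReal.ofReal m *
          (volume.restrict Ω {x | m < |ψ x|}) ^ (1 / (N : ℝ))) s hs).trans hw
    simp_rw [abs_of_nonneg (hψ0 _)] at h1
    rw [mul_comm, ← ENNReal.le_div_iff_mul_le (by simp [hs]) (by simp),
      ← ENNReal.ofReal_div_of_pos hs] at h1
    have h2 := ENNReal.rpow_le_rpow h1 hN0.le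
    rwa [← ENNReal.rpow_mul, one_div_mul_cancel hN0.ne', ENNReal.rpow_one,
      ENNReal.ofReal_rpow_of_nonneg (by positivity) hN0.le] at h2
  have h1 := lintegral_sq_mul_sq_le_of_weak hN' hK hψ hψ0 hw' (f := fun x => |φ x|)
    hφ.continuous.abs.measurable (fun _ => abs_nonneg _)
    (fun t ht => ((Measure.restrict_apply_le _ _).trans_lt (volume_lt_abs_lt_top hc ht)).ne)
  simp only [sq_abs] at h1
  have h2 : ∫⁻ t in Ioi (0 : ℝ), ENNReal.ofReal t *
      (volume.restrict Ω) {x | t < |φ x|} ^ (1 - 2 / (N : ℝ)) ≤ lorentzIntegral φ := by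
    refine lintegral_mono fun t => ?_
    refine mul_le_mul' le_rfl (ENNReal.rpow_le_rpow (Measure.restrict_apply_le _ _) ?_)
    rw [sub_nonneg, div_le_one] <;> linarith
  have h3 := lorentzIntegral_le hN hφ hc
  set D := ∫⁻ x, ‖fderiv ℝ φ x‖ₑ ^ 2
  set v := (volume (Metric.ball (0 : Eucl N) 1)).toReal
  have hc' : (N * volume (Metric.ball (0 : Eucl N) 1) ^ (1 / (N : ℝ))) =
      ENNReal.ofReal (N * v ^ (1 / (N : ℝ))) := by
    rw [ENNReal.ofReal_mul hN0.le, ← ENNReal.ofReal_rpow_of_pos hv,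
      ENNReal.ofReal_toReal measure_ball_lt_top.ne, ENNReal.ofReal_natCast]
  have h20 : ENNReal.ofReal 2 = 2 := ENNReal.ofReal_ofNat 2
  have h2m : ∀ y : ℝ, 2 * ENNReal.ofReal y = ENNReal.ofReal (2 * y) := fun y => by
    rw [ENNReal.ofReal_mul two_pos.le, h20]
  have hc0 : 0 < N * v ^ (1 / (N : ℝ)) := by positivity
  have h4 : lorentzIntegral φ ≤ ENNReal.ofReal (2 * (N / (N - 2)) / (N * v ^ (1 / (N : ℝ))) ^ 2) * D := by
    rw [hc', ← ENNReal.ofReal_pow hc0.le, mul_comm, ← ENNReal.le_div_iff_mul_le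
      (Or.inl (ENNReal.ofReal_pos.2 (pow_pos hc0 2)).ne') (Or.inl ENNReal.ofReal_ne_top)] at h3
    refine h3.trans (le_of_eq ?_)
    rw [ENNReal.ofReal_div_of_pos (x := 2 * (N / (N - 2) : ℝ)) (by positivity),
      ENNReal.ofReal_mul two_pos.le, h20, ENNReal.div_eq_inv_mul, ENNReal.div_eq_inv_mul]
    ring
  -- The constants combine to `S_{N,2} ^ 2`: the two factors `N / (N - 2)`, the two factors `2` and
  -- `(N ω^{1/N})^{-2}` give `(2 / ((N - 2) ω^{1/N})) ^ 2`.
  refine (h1.trans (mul_le_mul_right ((mul_le_mul_right (h2.trans h4)) _) _)).trans (le_of_eq ?_)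
  rw [sobolevConst_two_eq hN, ← ENNReal.ofReal_mul hK.le, ← ENNReal.ofReal_pow (by positivity),
    ← mul_assoc, ← mul_assoc, mul_assoc (ENNReal.ofReal _), h2m,
    ← ENNReal.ofReal_mul (by positivity)]
  congr 2
  rw [Real.rpow_neg hv.le]
  field_simp

end Sobolev

/-! ### Surjectivity of monotone operators in Hilbert spaces -/

section Minty

variable {H : Type*} [NormedAddCommGroup H] [InnerProductSpace ℝ H]

/-- A nonempty closed convex set of triples on which `r + ‖x‖² / 2 + ‖p‖² / 2` is bounded below
contains a minimizer of this function. -/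
theorem exists_forall_add_norm_sq_le [CompleteSpace H] {C : Set (H × H × ℝ)} (hne : C.Nonempty)
    (hcl : IsClosed C) (hcv : Convex ℝ C)
    (hb : ∀ w ∈ C, 0 ≤ w.2.2 + ‖w.1‖ ^ 2 / 2 + ‖w.2.1‖ ^ 2 / 2) :
    ∃ w ∈ C, ∀ z ∈ C, w.2.2 + ‖w.1‖ ^ 2 / 2 + ‖w.2.1‖ ^ 2 / 2 ≤
      z.2.2 + ‖z.1‖ ^ 2 / 2 + ‖z.2.1‖ ^ 2 / 2 := by
  set J : H × H × ℝ → ℝ := fun w => w.2.2 + ‖w.1‖ ^ 2 / 2 + ‖w.2.1‖ ^ 2 / 2 with hJ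
  have hbdd : BddBelow (J '' C) := ⟨0, by rintro _ ⟨w, hw, rfl⟩; exact hb w hw⟩
  set d := sInf (J '' C)
  have hd : ∀ w ∈ C, d ≤ J w := fun w hw => csInf_le hbdd (mem_image_of_mem _ hw)
  have hex : ∀ n : ℕ, ∃ w ∈ C, J w < d + 1 / ((n : ℝ) + 1) := by
    intro n
    obtain ⟨_, ⟨w, hw, rfl⟩, h⟩ := exists_lt_of_csInf_lt (hne.image J)
      (show d < d + 1 / ((n : ℝ) + 1) by
        have : 0 < 1 / ((n : ℝ) + 1) := by positivity
        linarith)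
    exact ⟨w, hw, h⟩
  choose w hwC hw using hex
  have hpar : ∀ x y : H, ‖(1 / 2 : ℝ) • x + (1 / 2 : ℝ) • y‖ ^ 2 =
      ‖x‖ ^ 2 / 2 + ‖y‖ ^ 2 / 2 - ‖x - y‖ ^ 2 / 4 := by
    intro x y
    rw [← smul_add, norm_smul, mul_pow, norm_add_sq_real, norm_sub_sq_real]
    norm_num
    ring
  -- Midpoints stay in `C`, so the parallelogram identity makes the first two components of a
  -- minimizing sequence Cauchy. The third converges because `J` does.
  have hmid : ∀ m n, ‖(w m).1 - (w n).1‖ ^ 2 + ‖(w m).2.1 - (w n).2.1‖ ^ 2 ≤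
      4 * (J (w m) + J (w n) - 2 * d) := by
    intro m n
    have h1 := hd _ (hcv (hwC m) (hwC n) (by norm_num : (0 : ℝ) ≤ 1 / 2)
      (by norm_num : (0 : ℝ) ≤ 1 / 2) (by norm_num))
    simp only [hJ, Prod.fst_add, Prod.snd_add, Prod.smul_fst, Prod.smul_snd, hpar,
      smul_eq_mul] at h1 ⊢
    linarith
  have hlim : Filter.Tendsto (fun n : ℕ => d + 1 / ((n : ℝ) + 1)) Filter.atTop (nhds d) := by
    simpa using (tendsto_one_div_add_atTop_nhds_zero_nat (𝕜 := ℝ)).const_add d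
  have hJlim : Filter.Tendsto (fun n => J (w n)) Filter.atTop (nhds d) :=
    tendsto_of_tendsto_of_tendsto_of_le_of_le tendsto_const_nhds hlim
      (fun n => hd _ (hwC n)) fun n => (hw n).le
  have hcau : ∀ f : ℕ → H, (∀ m n, ‖f m - f n‖ ^ 2 ≤ 4 * (J (w m) + J (w n) - 2 * d)) →
      CauchySeq f := by
    intro f hf
    rw [Metric.cauchySeq_iff]
    intro ε hε
    obtain ⟨M, hM⟩ := (hJlim.eventually (gt_mem_nhds
      (show d < d + ε ^ 2 / 8 by linarith [pow_pos hε 2]))).exists_forall_of_atTop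
    refine ⟨M, fun m hm n hn => ?_⟩
    rw [dist_eq_norm]
    refine lt_of_pow_lt_pow_left₀ 2 hε.le ((hf m n).trans_lt ?_)
    linarith [hM m hm, hM n hn]
  obtain ⟨x, hx⟩ := cauchySeq_tendsto_of_complete (hcau (fun n => (w n).1) fun m n =>
    le_trans (by simp) (hmid m n))
  obtain ⟨p, hp⟩ := cauchySeq_tendsto_of_complete (hcau (fun n => (w n).2.1) fun m n =>
    le_trans (by simp) (hmid m n))
  have hr : Filter.Tendsto (fun n => (w n).2.2) Filter.atTop
      (nhds (d - ‖x‖ ^ 2 / 2 - ‖p‖ ^ 2 / 2)) := by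
    refine ((hJlim.sub ((hx.norm.pow 2).div_const 2)).sub ((hp.norm.pow 2).div_const 2)).congr
      fun n => ?_
    simp only [hJ]
    ring
  refine ⟨(x, p, _), hcl.mem_of_tendsto (hx.prodMk_nhds (hp.prodMk_nhds hr))
    (Filter.Eventually.of_forall hwC), fun z hz => ?_⟩
  refine le_trans (le_of_eq ?_) (hd z hz)
  simp only
  ring

/-- Minty's theorem for everywhere defined, monotone, hemicontinuous operators. The solution is
found by minimizing the Fitzpatrick function plus `‖x‖² / 2 + ‖p‖² / 2`. -/
theorem exists_add_eq_zero_of_monotone [CompleteSpace H] {F : H → H}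
    (hmono : ∀ x y, 0 ≤ ⟪F x - F y, x - y⟫_ℝ)
    (hhemi : ∀ x z, Filter.Tendsto (fun s : ℝ => ⟪F (x + s • z), z⟫_ℝ) (nhdsWithin 0 (Ioi 0))
      (nhds ⟪F x, z⟫_ℝ)) :
    ∃ x, x + F x = 0 := by
  -- Minty's trick: test with `y = x + s • z`, divide by `s` and let `s → 0`.
  have hmax : ∀ x p, (∀ y, 0 ≤ ⟪F y - p, y - x⟫_ℝ) → F x = p := by
    intro x p h
    have h1 : ∀ z, 0 ≤ ⟪F x - p, z⟫_ℝ := by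
      intro z
      have h2 : Filter.Tendsto (fun s : ℝ => ⟪F (x + s • z) - p, z⟫_ℝ) (nhdsWithin 0 (Ioi 0))
          (nhds ⟪F x - p, z⟫_ℝ) := by
        simp only [inner_sub_left]
        exact (hhemi x z).sub_const _
      refine ge_of_tendsto h2 (eventually_nhdsWithin_of_forall fun s hs => ?_)
      have h3 := h (x + s • z)
      rw [add_sub_cancel_left, real_inner_smul_right] at h3
      exact nonneg_of_mul_nonneg_right h3 hs
    have h4 := h1 (-(F x - p))
    rw [inner_neg_right, neg_nonneg] at h4
    rw [real_inner_self_eq_norm_sq] at h4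
    exact sub_eq_zero.1 (norm_eq_zero.1 (pow_eq_zero_iff two_ne_zero |>.1
      (le_antisymm h4 (sq_nonneg _))))
  -- `C` is the epigraph of the Fitzpatrick function, a supremum of continuous affine functions. It
  -- contains the lifted graph of `F` by monotonicity and lies above `⟪x, p⟫` by `hmax`, so the
  -- functional to be minimized is at least `‖x + p‖ ^ 2 / 2` on it.
  set C : Set (H × H × ℝ) := {w | ∀ y, ⟪y, w.2.1⟫_ℝ + ⟪w.1, F y⟫_ℝ - ⟪y, F y⟫_ℝ ≤ w.2.2}
  have hgraph : ∀ y, (y, F y, ⟪y, F y⟫_ℝ) ∈ C := by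
    intro y z
    have := hmono y z
    simp only [inner_sub_left, inner_sub_right, real_inner_comm] at this ⊢
    linarith
  have hCge : ∀ w ∈ C, ⟪w.1, w.2.1⟫_ℝ ≤ w.2.2 := by
    intro w hw
    by_contra hlt
    push Not at hlt
    have h1 : F w.1 = w.2.1 := by
      refine hmax _ _ fun y => ?_
      have := hw y
      simp only [inner_sub_left, inner_sub_right, real_inner_comm] at this hlt ⊢
      linarith
    have h2 := hw w.1
    rw [h1] at h2
    linarith
  have hconv : Convex ℝ C := by
    intro w hw z hz a b ha hb hab y
    have h1 := mul_le_mul_of_nonneg_left (hw y) ha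
    have h2 := mul_le_mul_of_nonneg_left (hz y) hb
    simp only [Prod.fst_add, Prod.snd_add, Prod.smul_fst, Prod.smul_snd, smul_eq_mul,
      inner_add_left, inner_add_right, real_inner_smul_left, real_inner_smul_right]
    have h3 : ⟪y, F y⟫_ℝ = a * ⟪y, F y⟫_ℝ + b * ⟪y, F y⟫_ℝ := by rw [← add_mul, hab, one_mul]
    rw [h3]
    linarith
  have hsq : ∀ x p : H, ‖x + p‖ ^ 2 = ‖x‖ ^ 2 + 2 * ⟪x, p⟫_ℝ + ‖p‖ ^ 2 := norm_add_sq_real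
  have hcl : IsClosed C := by
    simp only [C, ofPred_forall]
    exact isClosed_iInter fun y => isClosed_le (by fun_prop) (by fun_prop)
  have hb : ∀ w ∈ C, 0 ≤ w.2.2 + ‖w.1‖ ^ 2 / 2 + ‖w.2.1‖ ^ 2 / 2 := by
    intro w hw
    have := hCge w hw
    have h1 := hsq w.1 w.2.1
    nlinarith [sq_nonneg ‖w.1 + w.2.1‖]
  obtain ⟨⟨x₀, p₀, r₀⟩, h₀, hmin⟩ := exists_forall_add_norm_sq_le ⟨_, hgraph 0⟩ hcl hconv hb
  have hr₀ : ⟪x₀, p₀⟫_ℝ ≤ r₀ := hCge _ h₀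
  -- First-order optimality along the segment from the minimizer to the lifted graph point over `y`.
  have hvar : ∀ y, r₀ - ⟪y, F y⟫_ℝ ≤ ⟪x₀, y - x₀⟫_ℝ + ⟪p₀, F y - p₀⟫_ℝ := by
    intro y
    set R := ⟪y, F y⟫_ℝ - r₀ + ⟪x₀, y - x₀⟫_ℝ + ⟪p₀, F y - p₀⟫_ℝ with hR
    set Q := ‖y - x₀‖ ^ 2 + ‖F y - p₀‖ ^ 2
    have h1 : ∀ s ∈ Ioo (0 : ℝ) 1, 0 ≤ R + s * (Q / 2) := by
      intro s hs
      have h2 := hmin _ (hconv h₀ (hgraph y) (sub_nonneg.2 hs.2.le) hs.1.le (sub_add_cancel _ _))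
      have h3 : ∀ a c : H, (1 - s) • a + s • c = a + s • (c - a) := fun a c => by
        rw [smul_sub, sub_smul, one_smul]
        abel
      simp only [Prod.fst_add, Prod.snd_add, Prod.smul_fst, Prod.smul_snd, smul_eq_mul, h3,
        hsq, norm_smul, real_inner_smul_right, mul_pow, Real.norm_eq_abs, sq_abs] at h2
      have h4 : 0 ≤ s * (R + s * (Q / 2)) := by
        simp only [hR, Q]
        linarith
      exact nonneg_of_mul_nonneg_right h4 hs.1
    have h2 : Filter.Tendsto (fun s : ℝ => R + s * (Q / 2)) (nhdsWithin 0 (Ioi 0)) (nhds R) := by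
      have : Continuous fun s : ℝ => R + s * (Q / 2) := by fun_prop
      simpa using (this.tendsto 0).mono_left nhdsWithin_le_nhds
    have h3 : 0 ≤ R := ge_of_tendsto h2 (by
      filter_upwards [Ioo_mem_nhdsGT (zero_lt_one (α := ℝ))] with s hs using h1 s hs)
    linarith
  -- With `hr₀` the optimality condition completes to a square. Hence `(-p₀, -x₀)` is monotonically
  -- related to the graph of `F`, so it lies on it, and `y = -p₀` then forces `x₀ + p₀ = 0`.
  have hrel : ∀ y, ‖x₀ + p₀‖ ^ 2 ≤ ⟪F y - -x₀, y - -p₀⟫_ℝ := by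
    intro y
    have := hvar y
    rw [hsq]
    simp only [inner_sub_left, inner_sub_right, inner_neg_left, inner_neg_right,
      real_inner_self_eq_norm_sq] at this ⊢
    have e1 := real_inner_comm y (F y)
    have e2 := real_inner_comm p₀ (F y)
    linarith
  have h1 : F (-p₀) = -x₀ := hmax _ _ fun y => (sq_nonneg _).trans (hrel y)
  have h2 := hrel (-p₀)
  rw [sub_self, inner_zero_right] at h2
  have h3 : x₀ + p₀ = 0 := by
    have : ‖x₀ + p₀‖ = 0 := pow_eq_zero_iff two_ne_zero |>.1 (le_antisymm h2 (sq_nonneg _))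
    exact norm_eq_zero.1 this
  refine ⟨-p₀, ?_⟩
  rw [h1, ← neg_add, add_comm, h3, neg_zero]

end Minty

/-- A strongly monotone, hemicontinuous operator from a Hilbert space to its dual is onto. -/
theorem exists_eq_of_strongly_monotone {H : Type*} [NormedAddCommGroup H] [InnerProductSpace ℝ H]
    [CompleteSpace H] {F : H → StrongDual ℝ H} {c : ℝ} (hc : 0 < c)
    (hmono : ∀ x y, c * ‖x - y‖ ^ 2 ≤ (F x - F y) (x - y))
    (hhemi : ∀ x z, Filter.Tendsto (fun s : ℝ => F (x + s • z) z) (nhdsWithin 0 (Ioi 0))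
      (nhds (F x z))) (ℓ : StrongDual ℝ H) :
    ∃ x, F x = ℓ := by
  set R := (InnerProductSpace.toDual ℝ H).symm
  have hR : ∀ (k : StrongDual ℝ H) y, ⟪R k, y⟫_ℝ = k y := fun k y =>
    InnerProductSpace.toDual_symm_apply
  -- Strong monotonicity leaves `c⁻¹ • R (F - ℓ)` monotone after the identity is subtracted. Adding
  -- the identity back, as Minty's theorem does, returns the equation `F x = ℓ`.
  have h1 : ∀ x y, 0 ≤ ⟪c⁻¹ • R (F x - ℓ) - x - (c⁻¹ • R (F y - ℓ) - y), x - y⟫_ℝ := by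
    intro x y
    have : c⁻¹ • R (F x - ℓ) - x - (c⁻¹ • R (F y - ℓ) - y) = c⁻¹ • R (F x - F y) - (x - y) := by
      rw [← sub_sub_sub_cancel_right (F x) (F y) ℓ, map_sub R (F x - ℓ), smul_sub]
      abel
    rw [this, inner_sub_left, real_inner_smul_left, hR, real_inner_self_eq_norm_sq, sub_nonneg,
      ← div_eq_inv_mul, le_div_iff₀ hc, mul_comm]
    exact hmono x y
  have h2 : ∀ x z, Filter.Tendsto (fun s : ℝ => ⟪c⁻¹ • R (F (x + s • z) - ℓ) - (x + s • z), z⟫_ℝ)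
      (nhdsWithin 0 (Ioi 0)) (nhds ⟪c⁻¹ • R (F x - ℓ) - x, z⟫_ℝ) := by
    intro x z
    simp only [inner_sub_left, real_inner_smul_left, hR, inner_add_left,
      sub_apply]
    have h3 : Filter.Tendsto (fun s : ℝ => ⟪x, z⟫_ℝ + s * ⟪z, z⟫_ℝ) (nhdsWithin 0 (Ioi 0))
        (nhds ⟪x, z⟫_ℝ) := by
      have : Continuous fun s : ℝ => ⟪x, z⟫_ℝ + s * ⟪z, z⟫_ℝ := by fun_prop
      simpa using (this.tendsto 0).mono_left nhdsWithin_le_nhds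
    exact (((hhemi x z).sub_const _).const_mul _).sub h3
  obtain ⟨x, hx⟩ := exists_add_eq_zero_of_monotone h1 h2
  rw [add_sub_cancel, smul_eq_zero, or_iff_right (by positivity)] at hx
  exact ⟨x, sub_eq_zero.1 ((map_eq_zero_iff R R.injective).1 hx)⟩

/-! ### Multiplication by weak Lebesgue functions on `W_0^{1,2}` -/

section Multiplication

variable {N : ℕ} {Ω : Set (Eucl N)}

theorem enorm_sq_eq_lintegral {X E : Type*} [MeasurableSpace X] {m : Measure X}
    [NormedAddCommGroup E] (f : Lp E 2 m) : ‖f‖ₑ ^ 2 = ∫⁻ x, ‖f x‖ₑ ^ 2 ∂m := by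
  rw [Lp.enorm_def, eLpNorm_eq_lintegral_rpow_enorm_toReal two_ne_zero ENNReal.ofNat_ne_top,
    ← ENNReal.rpow_natCast, ← ENNReal.rpow_mul]
  simp

theorem IsTestFunction.lintegral_enorm_fderiv_sq {φ : Eucl N → ℝ} (hφ : IsTestFunction Ω φ) :
    ∫⁻ x, ‖fderiv ℝ φ x‖ₑ ^ 2 = ∫⁻ x in Ω, ‖gradient φ x‖ₑ ^ 2 := by
  have h : ∀ x, ‖gradient φ x‖ₑ = ‖fderiv ℝ φ x‖ₑ := fun x => by
    rw [gradient, enorm_eq_iff_norm_eq, LinearIsometryEquiv.norm_map]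
  simp_rw [h]
  refine (setLIntegral_eq_of_support_subset ?_).symm
  intro x hx
  refine hφ.support (tsupport_fderiv_subset ℝ (subset_tsupport _ ?_))
  intro h0
  refine hx ?_
  simp only [h0]
  rw [← ofReal_norm, norm_zero]
  simp

/-- The multiplication inequality extends from `C_c^∞(Ω)` to `W_0^{1,2}(Ω)`. -/
theorem W012.setLIntegral_mul_le {ψ : Eucl N → ℝ≥0∞} (hψ : AEMeasurable ψ (volume.restrict Ω))
    (hψt : ∀ x, ψ x ≠ ⊤) {C : ℝ≥0∞} (hC : C ≠ ⊤)
    (h : ∀ φ, IsTestFunction Ω φ → ∫⁻ x in Ω, ψ x * ENNReal.ofReal (φ x ^ 2) ≤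
      C * ∫⁻ x, ‖fderiv ℝ φ x‖ₑ ^ 2) (u : W012 Ω) :
    ∫⁻ x in Ω, ψ x * ‖W012.toL2 Ω u x‖ₑ ^ 2 ≤ C * ‖W012.grad Ω u‖ₑ ^ 2 := by
  obtain ⟨w, hw, hlim⟩ := mem_closure_iff_seq_limit.1 (show u.1 ∈ closure (testPairs Ω : Set _)
    from u.2)
  have h1 : Filter.Tendsto (fun n => (w n).fst) Filter.atTop (nhds (W012.toL2 Ω u)) :=
    ((WithLp.fstL 2 ℝ (L2 Ω) (L2Vec Ω)).continuous.tendsto _).comp hlim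
  have h2 : Filter.Tendsto (fun n => (w n).snd) Filter.atTop (nhds (W012.grad Ω u)) :=
    ((WithLp.sndL 2 ℝ (L2 Ω) (L2Vec Ω)).continuous.tendsto _).comp hlim
  obtain ⟨ns, hns, hae⟩ := (tendstoInMeasure_of_tendsto_Lp h1).exists_seq_tendsto_ae
  have hbd : ∀ n, ∫⁻ x in Ω, ψ x * ‖(w n).fst x‖ₑ ^ 2 ≤ C * ‖(w n).snd‖ₑ ^ 2 := by
    intro n
    obtain ⟨φ, hφ, hf, hg⟩ := hw n
    rw [enorm_sq_eq_lintegral]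
    refine le_trans (le_of_eq (lintegral_congr_ae ?_)) ((h φ hφ).trans (le_of_eq ?_))
    · filter_upwards [hf] with x hx
      rw [hx, ← ofReal_norm, ← ENNReal.ofReal_pow (norm_nonneg _), Real.norm_eq_abs, sq_abs]
    · rw [hφ.lintegral_enorm_fderiv_sq]
      congr 1
      refine lintegral_congr_ae ?_
      filter_upwards [hg] with x hx
      rw [hx]
  -- The weight may be unbounded, so `L²` convergence alone does not pass to the limit on the left.
  -- Fatou's lemma along an almost everywhere convergent subsequence suffices.
  calc ∫⁻ x in Ω, ψ x * ‖W012.toL2 Ω u x‖ₑ ^ 2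
      ≤ ∫⁻ x in Ω, Filter.liminf (fun n => ψ x * ‖(w (ns n)).fst x‖ₑ ^ 2) Filter.atTop := by
        refine lintegral_mono_ae ?_
        filter_upwards [hae] with x hx
        have h3 : Filter.Tendsto (fun n => ‖(w (ns n)).fst x‖ₑ ^ 2) Filter.atTop
            (nhds (‖W012.toL2 Ω u x‖ₑ ^ 2)) := ENNReal.Tendsto.pow hx.enorm
        exact (ENNReal.Tendsto.const_mul h3 (Or.inr (hψt x))).liminf_eq.ge
    _ ≤ Filter.liminf (fun n => ∫⁻ x in Ω, ψ x * ‖(w (ns n)).fst x‖ₑ ^ 2) Filter.atTop :=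
        lintegral_liminf_le' fun n => hψ.mul ((Lp.aestronglyMeasurable _).enorm.pow_const 2)
    _ ≤ Filter.liminf (fun n => C * ‖(w (ns n)).snd‖ₑ ^ 2) Filter.atTop :=
        Filter.liminf_le_liminf (Filter.Eventually.of_forall fun n => hbd (ns n))
    _ = C * ‖W012.grad Ω u‖ₑ ^ 2 := by
        refine Filter.Tendsto.liminf_eq ?_
        exact ENNReal.Tendsto.const_mul (ENNReal.Tendsto.pow
          (h2.comp hns.tendsto_atTop).enorm) (Or.inr hC)

end Multiplication

/-! ### Carathéodory functions -/

/-- For a simple function in the second slot, the composition is a finite sum of measurable pieces.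
Continuity in that slot passes to the limit. -/
theorem IsCaratheodory.aestronglyMeasurable_comp {X E G : Type*} [MeasurableSpace X]
    [NormedAddCommGroup E] [NormedAddCommGroup G] {m : Measure X} {f : X → E → G}
    (hf : IsCaratheodory m f) {u : X → E} (hu : AEStronglyMeasurable u m) :
    AEStronglyMeasurable (fun x => f x (u x)) m := by
  obtain ⟨v, hv, huv⟩ := hu
  have h1 : AEStronglyMeasurable (fun x => f x (v x)) m := by
    refine aestronglyMeasurable_of_tendsto_ae Filter.atTop (f := fun n x => f x (hv.approx n x))
      (fun n => ?_) ?_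
    · have h2 : (fun x => f x (hv.approx n x)) = fun x => ∑ y ∈ (hv.approx n).range,
          (hv.approx n ⁻¹' {y}).indicator (fun x => f x y) x := by
        funext x
        classical
        rw [Finset.sum_eq_single (hv.approx n x)]
        · rw [indicator_of_mem]
          rfl
        · intro y _ hy
          exact indicator_of_notMem (fun h => hy h.symm) _
        · intro h
          exact absurd (SimpleFunc.mem_range_self _ x) h
      rw [h2]
      exact Finset.aestronglyMeasurable_fun_sum _ fun y _ =>
        (hf.measurable y).indicator ((hv.approx n).measurableSet_fiber y)
    · filter_upwards [hf.continuous] with x hx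
      exact (hx.tendsto _).comp (hv.tendsto_approx x)
  refine h1.congr ?_
  filter_upwards [huv] with x hx
  rw [hx]

/-! ### The truncated operator at a fixed time: monotonicity, hemicontinuity, solvability -/

section FixedTime

variable {N : ℕ} {Ω : Set (Eucl N)} {α β M : ℝ} {A : Eucl N → Eucl N → Eucl N}
  {B : Eucl N → ℝ → Eucl N} {b g : Eucl N → ℝ}

theorem continuous_trunc (M : ℝ) : Continuous (trunc M) := by
  unfold trunc
  fun_prop

theorem ae_eq_zero_of_weakLpNorm_eq_zero (hN : N ≠ 0) {ψ : Eucl N → ℝ} (h : weakLpNorm Ω N ψ = 0) :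
    ∀ᵐ x ∂volume.restrict Ω, ψ x = 0 := by
  have hN' : (0 : ℝ) < N := by positivity
  have h1 : ∀ n : ℕ, ∀ᵐ x ∂volume.restrict Ω, |ψ x| ≤ 1 / ((n : ℝ) + 1) := by
    intro n
    have hn : 0 < 1 / ((n : ℝ) + 1) := by positivity
    have h2 : ENNReal.ofReal (1 / ((n : ℝ) + 1)) *
        (volume.restrict Ω {x | 1 / ((n : ℝ) + 1) < |ψ x|}) ^ (1 / (N : ℝ)) ≤ 0 := by
      rw [← h]
      exact le_iSup₂ (f := fun (m : ℝ) (_ : 0 < m) => ENNReal.ofReal m *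
          (volume.restrict Ω {x | m < |ψ x|}) ^ (1 / (N : ℝ))) _ hn
    rw [nonpos_iff_eq_zero, mul_eq_zero, or_iff_right (ENNReal.ofReal_pos.2 hn).ne',
      ENNReal.rpow_eq_zero_iff_of_pos (by positivity)] at h2
    rw [ae_iff]
    simpa only [not_le] using h2
  filter_upwards [ae_all_iff.2 h1] with x hx
  have := ge_of_tendsto' (tendsto_one_div_add_atTop_nhds_zero_nat (𝕜 := ℝ)) hx
  exact abs_nonpos_iff.1 this

/-- For `N > 2` this is Alvino's inequality with `K = α / (2 S_{N,2})`, so that `K S_{N,2} = α / 2`.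
For `N = 2` the truncation bound is `0`, hence the excess vanishes almost everywhere. -/
theorem ConditionsAtTime.setLIntegral_excess_mul_le (hN : 2 ≤ N) (hα : 0 < α)
    (h : ConditionsAtTime Ω α β M A B b g) (u : W012 Ω) :
    ∫⁻ x in Ω, ENNReal.ofReal ((b x - trunc M (b x)) ^ 2) * ‖W012.toL2 Ω u x‖ₑ ^ 2 ≤
      ENNReal.ofReal (α / 2) ^ 2 * ‖W012.grad Ω u‖ₑ ^ 2 := by
  have hbm : AEMeasurable b (volume.restrict Ω) := h.structural.measurable_b.aemeasurable
  have hψ : AEMeasurable (fun x => b x - trunc M (b x)) (volume.restrict Ω) :=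
    hbm.sub ((continuous_trunc M).measurable.comp_aemeasurable hbm)
  have htr := h.truncation
  rcases eq_or_lt_of_le hN with rfl | hN
  · have hS : sobolevConst 2 2 = ⊤ := by
      have hv : volume (Metric.ball (0 : Eucl 2) 1) ^ (-(1 / ((2 : ℕ) : ℝ))) ≠ 0 := by
        rw [ENNReal.rpow_neg, ENNReal.inv_ne_zero]
        exact ENNReal.rpow_ne_top_of_nonneg (by positivity) measure_ball_lt_top.ne
      rw [sobolevConst]
      simp only [Nat.cast_ofNat, tsub_self, ENNReal.div_zero (two_ne_zero (α := ℝ≥0∞))]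
      exact ENNReal.mul_top hv
    rw [hS, ENNReal.mul_top two_ne_zero, ENNReal.div_top, nonpos_iff_eq_zero] at htr
    have h0 := ae_eq_zero_of_weakLpNorm_eq_zero two_ne_zero htr
    rw [lintegral_congr_ae (g := fun _ => 0)]
    · simp
    · filter_upwards [h0] with x hx
      rw [hx]
      simp
  · have hN' : (0 : ℝ) < N - 2 := by
      rw [sub_pos]
      exact_mod_cast hN
    have hne : Nonempty (Fin N) := ⟨⟨0, by lia⟩⟩
    have hv : 0 < (volume (Metric.ball (0 : Eucl N) 1)).toReal :=
      ENNReal.toReal_pos (Metric.measure_ball_pos _ _ one_pos).ne' measure_ball_lt_top.ne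
    obtain ⟨S, hS0, hS⟩ : ∃ S : ℝ, 0 < S ∧ sobolevConst N 2 = ENNReal.ofReal S :=
      ⟨_, by positivity, sobolevConst_two_eq hN⟩
    have hK : ENNReal.ofReal α / (2 * sobolevConst N 2) = ENNReal.ofReal (α / (2 * S)) := by
      rw [hS, ENNReal.ofReal_div_of_pos (by positivity), ENNReal.ofReal_mul two_pos.le,
        ENNReal.ofReal_ofNat]
    rw [hK] at htr
    have hKS : ENNReal.ofReal (α / (2 * S)) * sobolevConst N 2 = ENNReal.ofReal (α / 2) := by
      rw [hS, ← ENNReal.ofReal_mul (by positivity)]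
      congr 1
      field_simp
    refine W012.setLIntegral_mul_le (hψ.pow_const 2).ennreal_ofReal
      (fun _ => ENNReal.ofReal_ne_top) (by simp) (fun φ hφ => ?_) u
    have := setLIntegral_sq_mul_sq_le hN (hφ.smooth.of_le (by simp)) hφ.compact (Ω := Ω)
      (ψ := fun x => |b x - trunc M (b x)|) (K := α / (2 * S)) (by positivity)
      hψ.abs (fun _ => abs_nonneg _) (by simpa [weakLpNorm] using htr)
    rw [hKS] at this
    simpa only [sq_abs] using this

/-- The lower order part `(1 - θ_M) B(x, z)` of the truncated flux. -/
def lowerFlux (M : ℝ) (B : Eucl N → ℝ → Eucl N) (b : Eucl N → ℝ) (x : Eucl N) (z : ℝ) : Eucl N :=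
  (1 - trunc M (b x) / b x) • B x z

theorem StructureConditions.norm_lowerFlux_sub_le
    (h : StructureConditions (volume.restrict Ω) α β A B b g) :
    ∀ᵐ x ∂volume.restrict Ω, ∀ z z', ‖lowerFlux M B b x z - lowerFlux M B b x z'‖ ≤
      |b x - trunc M (b x)| * |z - z'| := by
  filter_upwards [h.lipschitz_B] with x hx z z'
  rw [lowerFlux, lowerFlux, ← smul_sub, norm_smul, Real.norm_eq_abs]
  rcases eq_or_ne (b x) 0 with h0 | h0
  -- Where `b x = 0` the Lipschitz bound makes `B x` constant, so the value of the quotient by zero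
  -- is irrelevant.
  · have h1 := hx z z'
    rw [h0, zero_mul] at h1
    rw [le_antisymm h1 (norm_nonneg _), mul_zero]
    positivity
  · have h1 : 0 ≤ b x := by
      have := (norm_nonneg _).trans (hx 1 0)
      simpa using this
    have h2 : b x - trunc M (b x) = (1 - trunc M (b x) / b x) * b x := by
      field_simp
    rw [h2, abs_mul, abs_of_nonneg h1, mul_assoc]
    exact mul_le_mul_of_nonneg_left (hx z z') (abs_nonneg _)

theorem StructureConditions.aestronglyMeasurable_lowerFlux
    (h : StructureConditions (volume.restrict Ω) α β A B b g) {u : Eucl N → ℝ}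
    (hu : AEStronglyMeasurable u (volume.restrict Ω)) :
    AEStronglyMeasurable (fun x => lowerFlux M B b x (u x)) (volume.restrict Ω) := by
  have hb := h.measurable_b.aemeasurable
  exact AEStronglyMeasurable.smul
    ((((continuous_trunc M).measurable.comp_aemeasurable hb).div hb).const_sub 1).aestronglyMeasurable
    (h.caratheodory_B.aestronglyMeasurable_comp hu)

/-- The pointwise Lipschitz bound reduces this to the multiplication inequality for `u - v`. The
constant is half of the monotonicity constant of `A`. -/
theorem ConditionsAtTime.eLpNorm_lowerFlux_sub_le (hN : 2 ≤ N) (hα : 0 < α)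
    (h : ConditionsAtTime Ω α β M A B b g) (u v : W012 Ω) :
    eLpNorm (fun x => lowerFlux M B b x (W012.toL2 Ω u x) - lowerFlux M B b x (W012.toL2 Ω v x)) 2
      (volume.restrict Ω) ≤ ENNReal.ofReal (α / 2 * ‖W012.grad Ω (u - v)‖) := by
  have h1 : ∫⁻ x in Ω, ‖lowerFlux M B b x (W012.toL2 Ω u x) -
      lowerFlux M B b x (W012.toL2 Ω v x)‖ₑ ^ 2 ≤ ENNReal.ofReal (α / 2 * ‖W012.grad Ω (u - v)‖) ^ 2 := by
    rw [ENNReal.ofReal_mul (by positivity), ofReal_norm, mul_pow]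
    refine le_trans (lintegral_mono_ae ?_) (h.setLIntegral_excess_mul_le hN hα (u - v))
    filter_upwards [h.structural.norm_lowerFlux_sub_le (M := M),
      Lp.coeFn_sub (W012.toL2 Ω u) (W012.toL2 Ω v)] with x hx hs
    rw [map_sub, hs, Pi.sub_apply, ← ofReal_norm, ← ofReal_norm, Real.norm_eq_abs,
      ← ENNReal.ofReal_pow (norm_nonneg _), ← ENNReal.ofReal_pow (abs_nonneg _),
      ← ENNReal.ofReal_mul (sq_nonneg _)]
    refine ENNReal.ofReal_le_ofReal ?_
    rw [← sq_abs (b x - trunc M (b x)), ← mul_pow]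
    exact pow_le_pow_left₀ (norm_nonneg _) (hx _ _) 2
  rw [eLpNorm_eq_lintegral_rpow_enorm_toReal two_ne_zero ENNReal.ofNat_ne_top]
  simp only [ENNReal.toReal_ofNat, ENNReal.rpow_two]
  refine (ENNReal.rpow_le_rpow h1 (by positivity)).trans (le_of_eq ?_)
  rw [← ENNReal.rpow_natCast, ← ENNReal.rpow_mul]
  norm_num

theorem ConditionsAtTime.memLp_lowerFlux (hN : 2 ≤ N) (hα : 0 < α)
    (h : ConditionsAtTime Ω α β M A B b g) (u : W012 Ω) :
    MemLp (fun x => lowerFlux M B b x (W012.toL2 Ω u x)) 2 (volume.restrict Ω) := by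
  refine ⟨h.structural.aestronglyMeasurable_lowerFlux (Lp.aestronglyMeasurable _), ?_⟩
  -- The lower order flux vanishes at `0`, so its Lipschitz bound is also a size bound.
  have h1 := h.eLpNorm_lowerFlux_sub_le hN hα u 0
  refine lt_of_le_of_lt (le_trans (le_of_eq (eLpNorm_congr_ae ?_)) h1) ENNReal.ofReal_lt_top
  filter_upwards [h.structural.zero_B, Lp.coeFn_zero ℝ 2 (volume.restrict Ω)] with x hx h0
  have h2 : W012.toL2 Ω 0 x = 0 := by
    rw [map_zero]
    exact h0
  rw [h2, lowerFlux, lowerFlux, hx, smul_zero, sub_zero]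

theorem StructureConditions.memLp_principalFlux
    (h : StructureConditions (volume.restrict Ω) α β A B b g) (G : L2Vec Ω) :
    MemLp (fun x => A x (G x)) 2 (volume.restrict Ω) := by
  refine MemLp.of_le (((Lp.memLp G).norm.const_mul β).add h.memLp_g)
    (h.caratheodory_A.aestronglyMeasurable_comp (Lp.aestronglyMeasurable _)) ?_
  filter_upwards [h.growth_A] with x hx
  exact (hx _).trans (le_abs_self _)

theorem ConditionsAtTime.memLp_truncatedFlux (hN : 2 ≤ N) (hα : 0 < α)
    (h : ConditionsAtTime Ω α β M A B b g) (u : W012 Ω) :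
    MemLp (truncatedFlux M A B b u) 2 (volume.restrict Ω) :=
  (h.structural.memLp_principalFlux (W012.grad Ω u)).add (h.memLp_lowerFlux hN hα u)

/-- The two parts of the truncated operator. -/
theorem ConditionsAtTime.truncatedOperator_eq (hN : 2 ≤ N) (hα : 0 < α)
    (h : ConditionsAtTime Ω α β M A B b g) (u w : W012 Ω) :
    truncatedOperator M A B b u w =
      ⟪(h.structural.memLp_principalFlux (W012.grad Ω u)).toLp _, W012.grad Ω w⟫_ℝ +
      ⟪(h.memLp_lowerFlux hN hα u).toLp _, W012.grad Ω w⟫_ℝ := by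
  rw [truncatedOperator, dif_pos (h.memLp_truncatedFlux hN hα u), ← inner_add_left,
    ← MemLp.toLp_add]
  rfl

theorem ConditionsAtTime.norm_lowerFlux_toLp_sub_le (hN : 2 ≤ N) (hα : 0 < α)
    (h : ConditionsAtTime Ω α β M A B b g) (u v : W012 Ω) :
    ‖(h.memLp_lowerFlux hN hα u).toLp _ - (h.memLp_lowerFlux hN hα v).toLp _‖ ≤
      α / 2 * ‖W012.grad Ω (u - v)‖ := by
  rw [← MemLp.toLp_sub, Lp.norm_toLp]
  exact ENNReal.toReal_le_of_le_ofReal (by positivity) (h.eLpNorm_lowerFlux_sub_le hN hα u v)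

theorem StructureConditions.inner_principalFlux_sub_ge
    (h : StructureConditions (volume.restrict Ω) α β A B b g) (G G' : L2Vec Ω) :
    α * ‖G - G'‖ ^ 2 ≤ ⟪(h.memLp_principalFlux G).toLp _ - (h.memLp_principalFlux G').toLp _,
      G - G'⟫_ℝ := by
  rw [← real_inner_self_eq_norm_sq, L2.inner_def, L2.inner_def, ← integral_const_mul]
  refine integral_mono_ae ((L2.integrable_inner _ _).const_mul _) (L2.integrable_inner _ _) ?_
  filter_upwards [h.monotone_A, Lp.coeFn_sub G G', (h.memLp_principalFlux G).coeFn_toLp,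
    (h.memLp_principalFlux G').coeFn_toLp, Lp.coeFn_sub ((h.memLp_principalFlux G).toLp _)
      ((h.memLp_principalFlux G').toLp _)] with x hx h1 h2 h3 h4
  rw [h4, h1, Pi.sub_apply, Pi.sub_apply, h2, h3, real_inner_self_eq_norm_sq]
  exact hx _ _

/-- The truncated operator is strongly monotone. -/
theorem ConditionsAtTime.truncatedOperator_monotone (hN : 2 ≤ N) (hα : 0 < α)
    (h : ConditionsAtTime Ω α β M A B b g) (u v : W012 Ω) :
    α / 2 * ‖W012.grad Ω (u - v)‖ ^ 2 ≤
      (truncatedOperator M A B b u - truncatedOperator M A B b v) (u - v) := by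
  rw [sub_apply, h.truncatedOperator_eq hN hα, h.truncatedOperator_eq hN hα,
    add_sub_add_comm, ← inner_sub_left, ← inner_sub_left]
  have h1 := h.structural.inner_principalFlux_sub_ge (W012.grad Ω u) (W012.grad Ω v)
  rw [← map_sub] at h1
  have h2 := h.norm_lowerFlux_toLp_sub_le hN hα u v
  have h3 := abs_real_inner_le_norm ((h.memLp_lowerFlux hN hα u).toLp _ -
    (h.memLp_lowerFlux hN hα v).toLp _) (W012.grad Ω (u - v))
  have h4 := mul_le_mul_of_nonneg_right h2 (norm_nonneg (W012.grad Ω (u - v)))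
  have h5 := (abs_le.1 (h3.trans h4)).1
  nlinarith

/-- Hemicontinuity of the principal part: dominated convergence, with the majorant given by linear
growth for `0 < s < 1`. -/
theorem StructureConditions.tendsto_inner_principalFlux
    (h : StructureConditions (volume.restrict Ω) α β A B b g) (G G' : L2Vec Ω) :
    Filter.Tendsto (fun s : ℝ => ⟪(h.memLp_principalFlux (G + s • G')).toLp _, G'⟫_ℝ)
      (nhdsWithin 0 (Ioi 0)) (nhds ⟪(h.memLp_principalFlux G).toLp _, G'⟫_ℝ) := by
  have e : ∀ s : ℝ, ∀ᵐ x ∂volume.restrict Ω,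
      ⟪(h.memLp_principalFlux (G + s • G')).toLp _ x, G' x⟫_ℝ = ⟪A x (G x + s • G' x), G' x⟫_ℝ := by
    intro s
    filter_upwards [(h.memLp_principalFlux (G + s • G')).coeFn_toLp, Lp.coeFn_add G (s • G'),
      Lp.coeFn_smul s G'] with x h1 h2 h3
    rw [h1, h2, Pi.add_apply, h3, Pi.smul_apply]
  have e0 : ∀ᵐ x ∂volume.restrict Ω,
      ⟪(h.memLp_principalFlux G).toLp _ x, G' x⟫_ℝ = ⟪A x (G x), G' x⟫_ℝ := by
    filter_upwards [(h.memLp_principalFlux G).coeFn_toLp] with x h1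
    rw [h1]
  simp only [L2.inner_def]
  rw [integral_congr_ae e0]
  simp_rw [fun s : ℝ => integral_congr_ae (e s)]
  refine tendsto_integral_filter_of_dominated_convergence
    (fun x => (|β| * (‖G x‖ + ‖G' x‖) + ‖g x‖) * ‖G' x‖)
    (Filter.Eventually.of_forall fun s =>
      (L2.integrable_inner _ _).aestronglyMeasurable.congr (e s)) ?_ ?_ ?_
  · filter_upwards [Ioo_mem_nhdsGT (zero_lt_one (α := ℝ))] with s hs
    filter_upwards [h.growth_A] with x hg
    refine (norm_inner_le_norm _ _).trans (mul_le_mul_of_nonneg_right ?_ (norm_nonneg _))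
    refine (hg _).trans (add_le_add ?_ (le_abs_self _))
    refine (mul_le_mul_of_nonneg_right (le_abs_self β) (norm_nonneg _)).trans
      (mul_le_mul_of_nonneg_left ?_ (abs_nonneg _))
    refine (norm_add_le _ _).trans (add_le_add le_rfl ?_)
    rw [norm_smul, Real.norm_of_nonneg hs.1.le]
    exact mul_le_of_le_one_left (norm_nonneg _) hs.2.le
  · exact MemLp.integrable_mul (((((Lp.memLp G).norm.add (Lp.memLp G').norm).const_mul |β|)).add
      h.memLp_g.norm) (Lp.memLp G').norm
  · filter_upwards [h.caratheodory_A.continuous] with x hx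
    have hc : Continuous fun s : ℝ => ⟪A x (G x + s • G' x), G' x⟫_ℝ := by fun_prop
    simpa using (hc.tendsto 0).mono_left nhdsWithin_le_nhds

theorem ConditionsAtTime.tendsto_truncatedOperator (hN : 2 ≤ N) (hα : 0 < α)
    (h : ConditionsAtTime Ω α β M A B b g) (u w : W012 Ω) :
    Filter.Tendsto (fun s : ℝ => truncatedOperator M A B b (u + s • w) w)
      (nhdsWithin 0 (Ioi 0)) (nhds (truncatedOperator M A B b u w)) := by
  simp only [h.truncatedOperator_eq hN hα, map_add, map_smul]
  refine (h.structural.tendsto_inner_principalFlux _ _).add ?_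
  rw [tendsto_iff_dist_tendsto_zero]
  refine squeeze_zero' (g := fun s : ℝ => α / 2 * (s * ‖W012.grad Ω w‖) * ‖W012.grad Ω w‖)
    (Filter.Eventually.of_forall fun _ => dist_nonneg) ?_ ?_
  · filter_upwards [self_mem_nhdsWithin] with s hs
    have h1 := h.norm_lowerFlux_toLp_sub_le hN hα (u + s • w) u
    rw [add_sub_cancel_left, map_smul, norm_smul, Real.norm_of_nonneg (le_of_lt hs)] at h1
    rw [Real.dist_eq, ← inner_sub_left]
    exact (abs_real_inner_le_norm _ _).trans (mul_le_mul_of_nonneg_right h1 (norm_nonneg _))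
  · have hc : Continuous fun s : ℝ => α / 2 * (s * ‖W012.grad Ω w‖) * ‖W012.grad Ω w‖ := by
      fun_prop
    simpa using (hc.tendsto 0).mono_left nhdsWithin_le_nhds

theorem W012.norm_sq_eq (u : W012 Ω) : ‖u‖ ^ 2 = ‖W012.toL2 Ω u‖ ^ 2 + ‖W012.grad Ω u‖ ^ 2 :=
  WithLp.prod_norm_sq_eq_of_L2 u.1

/-- Solvability of `u + κ 𝒜 u = f`. -/
theorem ConditionsAtTime.exists_resolvent (hN : 2 ≤ N) (hα : 0 < α)
    (h : ConditionsAtTime Ω α β M A B b g) {κ : ℝ} (hκ : 0 < κ) (f : L2 Ω) :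
    ∃ p ∈ graphL2 (truncatedOperator (Ω := Ω) M A B b), p.1 + κ • p.2 = f := by
  have : CompleteSpace (W012 Ω) :=
    (Submodule.isClosed_topologicalClosure (testPairs Ω)).completeSpace_coe
  set 𝒜 := truncatedOperator (Ω := Ω) M A B b
  have hT : ∀ f : L2 Ω, ∀ w : W012 Ω, L2.toWneg12 f w = ⟪f, W012.toL2 Ω w⟫_ℝ := fun _ _ => rfl
  -- The identity controls the `L²` part of the `W^{1,2}` norm and `κ 𝒜` the gradient part, whence
  -- the minimum of `1` and `κ α / 2`. No Poincaré inequality enters.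
  obtain ⟨u, hu⟩ := exists_eq_of_strongly_monotone
    (F := fun u : W012 Ω => L2.toWneg12 (W012.toL2 Ω u) + κ • 𝒜 u)
    (c := min 1 (κ * (α / 2))) (by positivity) (fun u v => by
      have h1 := mul_le_mul_of_nonneg_left (h.truncatedOperator_monotone hN hα u v) hκ.le
      have h2 : (L2.toWneg12 (W012.toL2 Ω u) + κ • 𝒜 u - (L2.toWneg12 (W012.toL2 Ω v) + κ • 𝒜 v))
          (u - v) = ‖W012.toL2 Ω (u - v)‖ ^ 2 + κ * (𝒜 u - 𝒜 v) (u - v) := by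
        change ⟪W012.toL2 Ω u, W012.toL2 Ω (u - v)⟫_ℝ + κ * 𝒜 u (u - v) -
          (⟪W012.toL2 Ω v, W012.toL2 Ω (u - v)⟫_ℝ + κ * 𝒜 v (u - v)) =
          ‖W012.toL2 Ω (u - v)‖ ^ 2 + κ * (𝒜 u (u - v) - 𝒜 v (u - v))
        have h3 : ‖W012.toL2 Ω (u - v)‖ ^ 2 = ⟪W012.toL2 Ω u, W012.toL2 Ω (u - v)⟫_ℝ -
            ⟪W012.toL2 Ω v, W012.toL2 Ω (u - v)⟫_ℝ := by
          rw [← inner_sub_left, ← map_sub, real_inner_self_eq_norm_sq]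
        rw [h3]
        ring
      rw [h2, W012.norm_sq_eq, mul_add]
      have h3 := mul_le_mul_of_nonneg_right (min_le_left 1 (κ * (α / 2)))
        (sq_nonneg ‖W012.toL2 Ω (u - v)‖)
      have h4 := mul_le_mul_of_nonneg_right (min_le_right 1 (κ * (α / 2)))
        (sq_nonneg ‖W012.grad Ω (u - v)‖)
      linarith) (fun u w => by
      refine Filter.Tendsto.add ?_ ((h.tendsto_truncatedOperator hN hα u w).const_mul κ)
      change Filter.Tendsto (fun s : ℝ => ⟪W012.toL2 Ω (u + s • w), W012.toL2 Ω w⟫_ℝ) _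
        (nhds ⟪W012.toL2 Ω u, W012.toL2 Ω w⟫_ℝ)
      simp only [map_add, map_smul]
      have hc : Continuous fun s : ℝ =>
        ⟪W012.toL2 Ω u + s • W012.toL2 Ω w, W012.toL2 Ω w⟫_ℝ := by fun_prop
      simpa using (hc.tendsto 0).mono_left nhdsWithin_le_nhds) (L2.toWneg12 f)
  refine ⟨(W012.toL2 Ω u, κ⁻¹ • (f - W012.toL2 Ω u)), ⟨u, rfl, ?_⟩, ?_⟩
  · ext w
    have h1 := DFunLike.congr_fun hu w
    simp only [add_apply, smul_apply, hT, smul_eq_mul] at h1 ⊢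
    rw [real_inner_smul_left, inner_sub_left, ← h1]
    field_simp
    ring
  · simp only
    rw [smul_inv_smul₀ hκ.ne', add_sub_cancel]

theorem ConditionsAtTime.isAccretive (hN : 2 ≤ N) (hα : 0 < α)
    (h : ConditionsAtTime Ω α β M A B b g) :
    IsAccretive (graphL2 (truncatedOperator (Ω := Ω) M A B b)) := by
  rintro ⟨_, y⟩ ⟨u, rfl, hy⟩ ⟨_, z⟩ ⟨v, rfl, hz⟩
  have h1 := h.truncatedOperator_monotone hN hα u v
  rw [hy, hz] at h1
  have h2 : (L2.toWneg12 y - L2.toWneg12 z) (u - v) =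
      ⟪y - z, W012.toL2 Ω u - W012.toL2 Ω v⟫_ℝ := by
    rw [← map_sub, inner_sub_left]
    rfl
  simp only at h2 h1 ⊢
  rw [← h2]
  exact le_trans (by positivity) h1

end FixedTime

/-! ### Resolvents of accretive graphs -/

section Resolvent

variable {H : Type*} [NormedAddCommGroup H] [InnerProductSpace ℝ H]

/-- Pair the difference of the two images with `p.1 - q.1`, drop the nonnegative accretivity term
and apply Cauchy–Schwarz. Uniqueness and nonexpansiveness of the resolvent both follow. -/
theorem IsAccretive.norm_sub_le {G : Set (H × H)} (hG : IsAccretive G) {κ : ℝ} (hκ : 0 < κ)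
    {p q : H × H} (hp : p ∈ G) (hq : q ∈ G) :
    ‖p.1 - q.1‖ ≤ ‖(p.1 + κ • p.2) - (q.1 + κ • q.2)‖ := by
  have h1 := hG p hp q hq
  have h2 : (p.1 + κ • p.2) - (q.1 + κ • q.2) = (p.1 - q.1) + κ • (p.2 - q.2) := by
    rw [smul_sub]
    abel
  have h3 : ⟪(p.1 - q.1) + κ • (p.2 - q.2), p.1 - q.1⟫_ℝ =
      ‖p.1 - q.1‖ ^ 2 + κ * ⟪p.2 - q.2, p.1 - q.1⟫_ℝ := by
    rw [inner_add_left, real_inner_smul_left, real_inner_self_eq_norm_sq]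
  have h4 := real_inner_le_norm ((p.1 - q.1) + κ • (p.2 - q.2)) (p.1 - q.1)
  rw [h2]
  rcases (norm_nonneg (p.1 - q.1)).eq_or_lt with h0 | h0
  · rw [← h0]
    exact norm_nonneg _
  · refine le_of_mul_le_mul_right ?_ h0
    nlinarith [mul_nonneg hκ.le h1]

theorem IsAccretive.exists_resolvent {G : Set (H × H)} (hG : IsAccretive G) {κ : ℝ} (hκ : 0 < κ)
    (hr : ∀ f, ∃ p ∈ G, p.1 + κ • p.2 = f) :
    ∃ J : H → H, IsResolvent κ G J ∧ ∀ f f', ‖J f - J f'‖ ≤ ‖f - f'‖ := by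
  choose P hPG hP using hr
  refine ⟨fun f => (P f).1, fun f u => ⟨?_, ?_⟩, fun f f' => ?_⟩
  · rintro rfl
    exact ⟨(P f).2, hPG f, hP f⟩
  · rintro ⟨y, hy, hyf⟩
    have h1 := hG.norm_sub_le hκ (hPG f) hy
    simp only [hP, hyf, sub_self, norm_zero] at h1
    exact sub_eq_zero.1 (norm_le_zero_iff.1 h1)
  · simpa only [hP] using hG.norm_sub_le hκ (hPG f) (hPG f')

end Resolvent

/-! ### Slices in time -/

section Slices

variable {X Y : Type*} [MeasurableSpace X] [MeasurableSpace Y] {μ : Measure X} {ν : Measure Y}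
  [SFinite μ] [SFinite ν]

theorem ae_ae_of_ae_prod_right {p : X × Y → Prop} (h : ∀ᵐ z ∂μ.prod ν, p z) :
    ∀ᵐ y ∂ν, ∀ᵐ x ∂μ, p (x, y) := by
  have h1 : ∀ᵐ z ∂ν.prod μ, p z.swap := by
    rw [← Measure.prod_swap] at h
    exact ae_of_ae_map measurable_swap.aemeasurable h
  exact Measure.ae_ae_of_ae_prod h1

theorem AEStronglyMeasurable.ae_slice {E : Type*} [TopologicalSpace E] {f : X × Y → E}
    (hf : AEStronglyMeasurable f (μ.prod ν)) :
    ∀ᵐ y ∂ν, AEStronglyMeasurable (fun x => f (x, y)) μ := by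
  obtain ⟨f', hf', h⟩ := hf
  filter_upwards [ae_ae_of_ae_prod_right h] with y hy
  exact ⟨fun x => f' (x, y), hf'.comp_measurable measurable_prodMk_right, hy⟩

/-- Each `η` has its own exceptional set of times. A countable dense set of `η` has a common one,
and continuity recovers measurability for the remaining `η`. -/
theorem IsCaratheodory.ae_slice {E F : Type*} [TopologicalSpace E]
    [TopologicalSpace.SeparableSpace E] [FirstCountableTopology E] [TopologicalSpace F]
    [TopologicalSpace.PseudoMetrizableSpace F] {f : X × Y → E → F}
    (hf : IsCaratheodory (μ.prod ν) f) : ∀ᵐ y ∂ν, IsCaratheodory μ fun x => f (x, y) := by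
  obtain ⟨D, hD, hDd⟩ := TopologicalSpace.exists_countable_dense E
  have h1 : ∀ᵐ y ∂ν, ∀ η ∈ D, AEStronglyMeasurable (fun x => f (x, y) η) μ :=
    (ae_ball_iff hD).2 fun η _ => AEStronglyMeasurable.ae_slice (hf.measurable η)
  filter_upwards [h1, ae_ae_of_ae_prod_right hf.continuous] with y hy hc
  refine ⟨fun η => ?_, hc⟩
  obtain ⟨u, huD, hu⟩ := mem_closure_iff_seq_limit.1 (hDd η)
  refine aestronglyMeasurable_of_tendsto_ae Filter.atTop (fun n => hy _ (huD n)) ?_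
  filter_upwards [hc] with x hx
  exact (hx.tendsto _).comp hu

theorem MemLp.ae_slice_two {f : X × Y → ℝ} (hf : MemLp f 2 (μ.prod ν)) :
    ∀ᵐ y ∂ν, MemLp (fun x => f (x, y)) 2 μ := by
  have h1 := ((memLp_two_iff_integrable_sq hf.1).1 hf).swap
  filter_upwards [AEStronglyMeasurable.ae_slice hf.1, h1.prod_right_ae] with y hy hi
  exact (memLp_two_iff_integrable_sq hy).2 hi

theorem StructureConditions.ae_slice {N : ℕ} {α β : ℝ} {A : X × Y → Eucl N → Eucl N}
    {B : X × Y → ℝ → Eucl N} {b g : X × Y → ℝ} (h : StructureConditions (μ.prod ν) α β A B b g) :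
    ∀ᵐ y ∂ν, StructureConditions μ α β (fun x => A (x, y)) (fun x => B (x, y))
      (fun x => b (x, y)) (fun x => g (x, y)) := by
  filter_upwards [h.caratheodory_A.ae_slice, MemLp.ae_slice_two h.memLp_g,
    ae_ae_of_ae_prod_right h.growth_A, ae_ae_of_ae_prod_right h.monotone_A,
    h.caratheodory_B.ae_slice, AEStronglyMeasurable.ae_slice h.measurable_b,
    ae_ae_of_ae_prod_right h.lipschitz_B, ae_ae_of_ae_prod_right h.zero_B]
    with y h1 h2 h3 h4 h5 h6 h7 h8
  exact ⟨h1, h2, h3, h4, h5, h6, h7, h8⟩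

end Slices

theorem ae_conditionsAtTime {N : ℕ} {Ω : Set (Eucl N)} {T α β M : ℝ}
    {A : Eucl N → ℝ → Eucl N → Eucl N} {B : Eucl N → ℝ → ℝ → Eucl N} {b g : Eucl N → ℝ → ℝ}
    (hAB : StructureConditions ((volume.restrict Ω).prod (volume.restrict (Ioo 0 T))) α β
      (fun p => A p.1 p.2) (fun p => B p.1 p.2) (fun p => b p.1 p.2) (fun p => g p.1 p.2))
    (hb : essSup (fun t => weakLpNorm Ω N (fun x => b x t)) (volume.restrict (Ioo 0 T)) < ⊤)
    (hbM : essSup (fun t => weakLpNorm Ω N (fun x => b x t - trunc M (b x t)))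
      (volume.restrict (Ioo 0 T)) ≤ ENNReal.ofReal α / (2 * sobolevConst N 2)) :
    ∀ᵐ t ∂(volume.restrict (Ioo 0 T)), ConditionsAtTime Ω α β M
      (fun x => A x t) (fun x => B x t) (fun x => b x t) (fun x => g x t) := by
  filter_upwards [hAB.ae_slice,
    ENNReal.ae_le_essSup (μ := volume.restrict (Ioo 0 T)) fun t => weakLpNorm Ω N (fun x => b x t),
    ENNReal.ae_le_essSup (μ := volume.restrict (Ioo 0 T))
      fun t => weakLpNorm Ω N (fun x => b x t - trunc M (b x t))] with t h1 h2 h3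
  exact ⟨h1, h2.trans_lt hb, h3.trans hbM⟩

end

theorem proposition3p2 {N : ℕ} (hN : 2 ≤ N) {Ω : Set (Eucl N)} (hΩ : IsOpen Ω)
    (hΩb : Bornology.IsBounded Ω) {T : ℝ} (hT : 0 < T) {α β : ℝ} (hα : 0 < α) (hβ : 0 < β)
    (A : Eucl N → ℝ → Eucl N → Eucl N) (B : Eucl N → ℝ → ℝ → Eucl N) (b g : Eucl N → ℝ → ℝ)
    -- the hypotheses on `A`, `B`, `g` on `Ω_T = Ω × (0, T)`
    (hAB : StructureConditions ((volume.restrict Ω).prod (volume.restrict (Ioo 0 T))) α β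
      (fun p => A p.1 p.2) (fun p => B p.1 p.2) (fun p => b p.1 p.2) (fun p => g p.1 p.2))
    -- `b ∈ L^∞(0, T; L^{N,∞}(Ω))`
    (hb : essSup (fun t => weakLpNorm Ω N (fun x => b x t)) (volume.restrict (Ioo 0 T)) < ⊤)
    -- the truncation level
    {M : ℝ} (hM : 0 < M)
    (hbM : essSup (fun t => weakLpNorm Ω N (fun x => b x t - trunc M (b x t)))
      (volume.restrict (Ioo 0 T)) ≤ ENNReal.ofReal α / (2 * sobolevConst N 2)) :
    -- the hypotheses hold at almost every time
    (∀ᵐ t ∂(volume.restrict (Ioo 0 T)), ConditionsAtTime Ω α β M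
      (fun x => A x t) (fun x => B x t) (fun x => b x t) (fun x => g x t)) ∧
    -- and at every time at which they hold, the operator has the asserted properties
    ∀ t ∈ Icc 0 T, ConditionsAtTime Ω α β M
        (fun x => A x t) (fun x => B x t) (fun x => b x t) (fun x => g x t) →
      ∀ 𝒜 : W012 Ω → Wneg12 Ω,
        𝒜 = truncatedOperator M (fun x => A x t) (fun x => B x t) (fun x => b x t) →
      -- `𝒜` is well defined from `W_0^{1,2}(Ω)` to `W^{-1,2}(Ω)`
      (∀ u : W012 Ω, MemLp
        (truncatedFlux M (fun x => A x t) (fun x => B x t) (fun x => b x t) u) 2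
        (volume.restrict Ω)) ∧
      -- (i) accretivity
      (∀ u v : W012 Ω, α / 2 * ‖W012.grad Ω (u - v)‖ ^ 2 ≤ (𝒜 u - 𝒜 v) (u - v)) ∧
      IsAccretive (graphL2 𝒜) ∧
      -- (ii) range condition
      (∀ κ : ℝ, 0 < κ → rangeIdAdd κ (graphL2 𝒜) = univ) ∧
      -- (iii) the resolvents are single-valued, defined on all of `L²(Ω)`, and nonexpansive
      (∀ κ : ℝ, 0 < κ → ∃ J : L2 Ω → L2 Ω, IsResolvent κ (graphL2 𝒜) J ∧
        ∀ f f' : L2 Ω, ‖J f - J f'‖ ≤ ‖f - f'‖) := by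
  refine ⟨ae_conditionsAtTime hAB hb hbM, ?_⟩
  rintro t - h 𝒜 rfl
  exact ⟨h.memLp_truncatedFlux hN hα, h.truncatedOperator_monotone hN hα, h.isAccretive hN hα,
    fun κ hκ => eq_univ_of_forall fun f => h.exists_resolvent hN hα hκ f,
    fun κ hκ => (h.isAccretive hN hα).exists_resolvent hκ fun f => h.exists_resolvent hN hα hκ f⟩
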